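/- For an integer $n\ge 1$ put $[n]=\{1,\dots,n\}$ and $[0]=\emptyset$. Two subsets $X,Y$ of $[n]$ are in general position if $X\cup Y=[n]$ or $X\cap Y=\emptyset$. For $1\le a<b\le n-1$ let $\Gamma(n,\{a,b\})$ be the graph whose vertices are the pairs $(A,B)$ of sets with $A\subseteq B\subseteq[n]$, $|A|=a$, $|B|=b$ (flags of $[n]$ of type $\{a,b\}$), where $(A,B)$ and $(A',B')$ are adjacent if each of $A,B$ is in general position to each of $A',B'$. Write $\alpha$ for the independence number. Two independent sets of a graph are called equivalent if they lie in the same orbit of the automorphism group of the graph. Let $a,b,n$ be positive integers with $a<\frac n2<b$ and $a+b<n$. For $0\le i\le 2b-n+1$ let $\mathcal F_i(n,a,b)$ be the set of all vertices $(A,B)$ of $\Gamma(n,\{a,b\})$ that satisfy at least one of (I) $[i]\subseteq B\subseteq[n-1]$, (II) $\min A\le i$ and $[\min A]\subseteq B$. For $i=2b-n+1$ let $\bar{\mathcal F}_i(n,a,b)$ be the set of all vertices $(A,B)$ of $\Gamma(n,\{a,b\})$ that satisfy $[i]\subseteq B$ or (II). Theorem. Let $n\ge 5$ be an integer. Then $$\alpha(\Gamma(n,\{1,n-2\}))=\binom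 n3+2 .$$ The sets $\mathcal F_{n-5}(n,1,n-2)$, $\mathcal F_{n-4}(n,1,n-2)$ and $\bar{\mathcal F}_{n-3}(n,1,n-2)$ are pairwise non-equivalent independent sets of $\Gamma(n,\{1,n-2\})$ of cardinality $\binom n3+2$, and every independent set of $\Gamma(n,\{1,n-2\})$ of cardinality $\binom n3+2$ is equivalent to one of these three sets. -/

import Mathlib

/-- Two subsets `X`, `Y` of `S` are in general position (with respect to `S`) if their union is
`S` or they are disjoint. -/
def SetsInGeneralPosition {α : Type*} [DecidableEq α] (S X Y : Finset α) : Prop :=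
  X ∪ Y = S ∨ X ∩ Y = ∅

/-- A flag of `S`: a set of non-empty proper subsets of `S`, any two of which are comparable. -/
def IsFlagOf {α : Type*} (S : Finset α) (f : Finset (Finset α)) : Prop :=
  (∀ X ∈ f, X.Nonempty ∧ X ⊂ S) ∧ ∀ X ∈ f, ∀ Y ∈ f, X ⊆ Y ∨ Y ⊆ X

/-- The type of a flag: the set of the cardinalities of its members. -/
def flagType {α : Type*} (f : Finset (Finset α)) : Finset ℕ :=
  f.image Finset.card

/-- Two flags of `S` are in general position if every member of the first is in general position
to every member of the second. -/
def FlagsInGeneralPosition {α : Type*} [DecidableEq α] (S : Finset α)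
    (f g : Finset (Finset α)) : Prop :=
  ∀ X ∈ f, ∀ Y ∈ g, SetsInGeneralPosition S X Y

/-- The flags of `S` of type `T`. -/
abbrev FlagOfType {α : Type*} (S : Finset α) (T : Finset ℕ) : Type _ :=
  {f : Finset (Finset α) // IsFlagOf S f ∧ flagType f = T}

/-- The graph `Γ(S, T)`: its vertices are the flags of `S` of type `T`, and two distinct vertices
are adjacent when the flags are in general position. (For non-empty `T` no flag is in general
position to itself, so that distinctness is automatic.) -/
def flagGraph {α : Type*} [DecidableEq α] (S : Finset α) (T : Finset ℕ) :
    SimpleGraph (FlagOfType S T) where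
  Adj f g := f ≠ g ∧ FlagsInGeneralPosition S f.1 g.1
  symm := ⟨by
    rintro f g ⟨hne, h⟩
    refine ⟨hne.symm, fun X hX Y hY => ?_⟩
    rcases h Y hY X hX with h' | h'
    · exact Or.inl (by rw [Finset.union_comm]; exact h')
    · exact Or.inr (by rw [Finset.inter_comm]; exact h')⟩
  loopless := ⟨fun _ h => h.1 rfl⟩

/-- The vertices of `Γ(n, T)`: the flags of `[n] = {1, …, n}` of type `T`. -/
abbrev GammaVertex (n : ℕ) (T : Finset ℕ) : Type :=
  FlagOfType (Finset.Icc 1 n) T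

/-- The graph `Γ(n, T)`, that is `Γ([n], T)` for `[n] = {1, …, n}`. -/
abbrev Gamma (n : ℕ) (T : Finset ℕ) : SimpleGraph (GammaVertex n T) :=
  flagGraph (Finset.Icc 1 n) T

/-- For a flag `(A, B)` and a number `i`: `min A ≤ i` and `[min A] ⊆ B`. -/
def MinCondition (i : ℕ) (A B : Finset ℕ) : Prop :=
  ∃ m, IsLeast (A : Set ℕ) m ∧ m ≤ i ∧ Finset.Icc 1 m ⊆ B

/-- The set `F_i(n, a, b)` of all vertices `{A, B}` of `Γ(n, {a, b})`, where `|A| = a` and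
`|B| = b`, with `[i] ⊆ B ⊆ [n - 1]`, or with `min A ≤ i` and `[min A] ⊆ B`. -/
def familyF (i n a b : ℕ) : Set (GammaVertex n {a, b}) :=
  {f | ∃ A B : Finset ℕ, f.1 = {A, B} ∧ A.card = a ∧ B.card = b ∧
    ((Finset.Icc 1 i ⊆ B ∧ B ⊆ Finset.Icc 1 (n - 1)) ∨ MinCondition i A B)}

/-- The set `F̄_i(n, a, b)` (used for `i = 2b - n + 1`) of all vertices `{A, B}` of `Γ(n, {a, b})`,
where `|A| = a` and `|B| = b`, with `[i] ⊆ B`, or with `min A ≤ i` and `[min A] ⊆ B`. -/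
def familyFBar (i n a b : ℕ) : Set (GammaVertex n {a, b}) :=
  {f | ∃ A B : Finset ℕ, f.1 = {A, B} ∧ A.card = a ∧ B.card = b ∧
    (Finset.Icc 1 i ⊆ B ∨ MinCondition i A B)}

/-- Two sets of vertices of a graph are equivalent if they are in the same orbit under the
automorphism group of the graph. -/
def EquivalentUnderAut {V : Type*} (G : SimpleGraph V) (F F' : Set V) : Prop :=
  ∃ φ : G ≃g G, φ '' F = F'

/-! Write a flag with `A = {n - x}` and `B = [n] \ {n - y, n - z}` as the pointed triple `(x, {y,
z})` of labels in `{0, …, n - 1}`. Two flags are adjacent exactly when they have the form `(x, {y,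
z})` and `(y, {x, w})` with `z ≠ w`. Independent sets thus become relations satisfying `IndepRel`,
and the claim becomes that such a relation has at most `C(n,3) + 2` pointed triples. Counts run over
ordered pairs `(y, z)`, so all of them are doubled.

`extremalBound` proves the bound together with its equality cases by induction on `n`. An element
that is never a non-pointed member (`IsDominant`) lies in at most `C(n-1,2)` pointed triples, which
is exactly the growth of the bound. Deleting it proves the step, and equality forces it to be a
source. Extremal relations are therefore sources stacked on one of three cores: one triple pointed
at all three members, or, on 4 or 5 labels, all triples through 0, each pointed at both its other
members.

It remains to treat relations without a dominant element, or to find one. For `n = 4, 5, 6` a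
tournament-like count of out-neighbours and mutual neighbours does this; it also produces the cores
on 4 and 5 labels. For `n ≥ 7` averaging gives an element `w` of degree at most `C(n-1,2)`. Removing
it leaves an extremal relation on at least 6 labels, hence one with a source `w'`. The bound for the
relation without `w'` makes the degree of `w'` large, and then `w` or `w'` is dominant.

Permuting labels induces graph automorphisms, so relations with the same model give equivalent sets.
Non-equivalence follows from an invariant: the graph induced on the vertices outside `F` with
exactly two neighbours in `F`. -/

/-- The relation `R x y z` says that `(x, {y, z})` belongs to a family of pointed triples; the
conditions say that this family is independent. -/
structure IndepRel (R : ℕ → ℕ → ℕ → Prop) : Prop where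
  symm : ∀ {x y z}, R x y z → R x z y
  ne_left : ∀ {x y z}, R x y z → x ≠ y
  ne : ∀ {x y z}, R x y z → y ≠ z
  unique : ∀ {x y z w}, R x y z → R y x w → z = w

/-! ### Counting pointed triples and degrees -/

namespace IndepRel

open Finset
open scoped Classical

/-- The number of pairs `(y, z)` in `V` with `R x y z`. -/
noncomputable def outCount (R : ℕ → ℕ → ℕ → Prop) (V : Finset ℕ) (x : ℕ) : ℕ :=
  ∑ y ∈ V, ∑ z ∈ V, if R x y z then 1 else 0

/-- The number of pairs `(y, z)` in `V` with `R y x z`. -/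
noncomputable def inCount (R : ℕ → ℕ → ℕ → Prop) (V : Finset ℕ) (x : ℕ) : ℕ :=
  ∑ y ∈ V, ∑ z ∈ V, if R y x z then 1 else 0

/-- The number of triples `(x, y, z)` in `V` with `R x y z`. -/
noncomputable def count (R : ℕ → ℕ → ℕ → Prop) (V : Finset ℕ) : ℕ :=
  ∑ x ∈ V, outCount R V x

variable {R : ℕ → ℕ → ℕ → Prop} {V : Finset ℕ}

theorem ne_right (h : IndepRel R) {x y z : ℕ} (hR : R x y z) : x ≠ z :=
  h.ne_left (h.symm hR)

theorem not_self_left (h : IndepRel R) {x z : ℕ} : ¬ R x x z := fun hR => h.ne_left hR rfl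

theorem not_self_right (h : IndepRel R) {x y : ℕ} : ¬ R x y x := fun hR => h.ne_right hR rfl

theorem not_self (h : IndepRel R) {x y : ℕ} : ¬ R x y y := fun hR => h.ne hR rfl

theorem comm (h : IndepRel R) {x y z : ℕ} : R x y z ↔ R x z y := ⟨h.symm, h.symm⟩

theorem outCount_eq_card (R : ℕ → ℕ → ℕ → Prop) (V : Finset ℕ) (x : ℕ) :
    outCount R V x = #{p ∈ V ×ˢ V | R x p.1 p.2} := by
  rw [outCount, ← Finset.sum_product', card_filter]

theorem outCount_insert (h : IndepRel R) {w u : ℕ} (hw : w ∉ V) :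
    outCount R (insert w V) u
      = outCount R V u + 2 * ∑ z ∈ V, if R u w z then 1 else 0 := by
  have h2 : ∀ y, (if R u y w then 1 else 0) = if R u w y then 1 else 0 := fun y => by
    simp only [h.comm (y := y)]
  simp only [outCount, sum_insert hw, h.not_self, if_false, sum_add_distrib, h2]
  ring

theorem outCount_insert_self (h : IndepRel R) {w : ℕ} (hw : w ∉ V) :
    outCount R (insert w V) w = outCount R V w := by
  rw [outCount_insert h hw]
  simp [h.not_self_left]

/-- A triple in which `w` is not pointed occurs in both orders in `count` but once in `inCount`. So
`outCount + 2 * inCount` is the degree of `w`, the amount lost by deleting it. -/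
theorem count_insert (h : IndepRel R) {w : ℕ} (hw : w ∉ V) :
    count R (insert w V) = count R V + outCount R V w + 2 * inCount R V w := by
  rw [count, sum_insert hw, outCount_insert_self h hw,
    sum_congr rfl fun u _ => outCount_insert h hw, sum_add_distrib, ← mul_sum]
  simp only [count, inCount]
  ring

theorem outCount_eq_erase (h : IndepRel R) {w : ℕ} (hw : w ∈ V) :
    outCount R V w = outCount R (V.erase w) w := by
  conv_lhs => rw [← insert_erase hw]
  exact outCount_insert_self h (notMem_erase w V)

theorem inCount_eq_erase (h : IndepRel R) {w : ℕ} (hw : w ∈ V) :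
    inCount R V w = inCount R (V.erase w) w := by
  conv_lhs => rw [← insert_erase hw]
  simp only [inCount, sum_insert (notMem_erase w V), h.not_self_left, h.not_self, if_false,
    sum_const_zero, zero_add]

theorem count_eq_erase (h : IndepRel R) {w : ℕ} (hw : w ∈ V) :
    count R V = count R (V.erase w) + outCount R V w + 2 * inCount R V w := by
  rw [outCount_eq_erase h hw, inCount_eq_erase h hw, ← count_insert h (notMem_erase w V),
    insert_erase hw]

theorem sum_degree (R : ℕ → ℕ → ℕ → Prop) (V : Finset ℕ) :
    ∑ w ∈ V, (outCount R V w + 2 * inCount R V w) = 3 * count R V := by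
  have h1 : ∑ w ∈ V, inCount R V w = count R V := by
    simp only [inCount, count, outCount]
    rw [sum_comm]
  rw [sum_add_distrib, ← mul_sum, h1]
  simp only [count]
  ring

theorem even_outCount (h : IndepRel R) (V : Finset ℕ) (u : ℕ) : Even (outCount R V u) := by
  induction V using Finset.induction_on with
  | empty => simp [outCount]
  | insert w V hw ih =>
    rw [outCount_insert h hw]
    exact ih.add (even_two_mul _)

theorem even_count (h : IndepRel R) (V : Finset ℕ) : Even (count R V) :=
  even_sum _ fun _ _ => even_outCount h _ _

theorem outCount_filter_subset (h : IndepRel R) (V : Finset ℕ) (u : ℕ) :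
    {p ∈ V ×ˢ V | R u p.1 p.2} ⊆ (V.erase u).offDiag := by
  intro p hp
  simp only [mem_filter, mem_product] at hp
  simp only [mem_offDiag, mem_erase]
  exact ⟨⟨(h.ne_left hp.2).symm, hp.1.1⟩, ⟨(h.ne_right hp.2).symm, hp.1.2⟩, h.ne hp.2⟩

theorem outCount_le (h : IndepRel R) {u : ℕ} (hu : u ∈ V) :
    outCount R V u ≤ (#V - 1) * (#V - 2) := by
  rw [outCount_eq_card]
  refine (card_le_card (outCount_filter_subset h V u)).trans_eq ?_
  rw [offDiag_card, card_erase_of_mem hu, ← Nat.mul_sub_one]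
  rfl

/-- The vertex `u` is pointed in all triples of `V` that contain it. -/
def IsSource (R : ℕ → ℕ → ℕ → Prop) (V : Finset ℕ) (u : ℕ) : Prop :=
  ∀ y ∈ V, ∀ z ∈ V, u ≠ y → u ≠ z → y ≠ z → R u y z

/-- The vertex `u` is not a non-pointed element of a triple of the family. -/
def IsDominant (R : ℕ → ℕ → ℕ → Prop) (V : Finset ℕ) (u : ℕ) : Prop :=
  ∀ x ∈ V, ∀ z ∈ V, ¬ R x u z

theorem isSource_of_outCount (h : IndepRel R) {u : ℕ} (hu : u ∈ V)
    (hc : (#V - 1) * (#V - 2) ≤ outCount R V u) : IsSource R V u := by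
  have he := eq_of_subset_of_card_le (outCount_filter_subset h V u) (by
    rw [← outCount_eq_card, offDiag_card, card_erase_of_mem hu, ← Nat.mul_sub_one]
    exact hc)
  intro y hy z hz hy' hz' hyz
  have : (y, z) ∈ (V.erase u).offDiag := by
    simp [mem_offDiag, *, Ne.symm hy', Ne.symm hz']
  rw [← he] at this
  exact (mem_filter.1 this).2

/-- If `R x u z`, choose a fourth element `t`. The source gives `R u x t`, and `unique` forces `z =
t`. -/
theorem IsSource.isDominant (h : IndepRel R) {u : ℕ} (hs : IsSource R V u) (hV : 4 ≤ #V) :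
    IsDominant R V u := by
  intro x hx z hz hR
  obtain ⟨t, ht⟩ : ((V \ {u, x, z} : Finset ℕ)).Nonempty := by
    rw [← card_pos]
    have := le_card_sdiff {u, x, z} V
    have h3 : #({u, x, z} : Finset ℕ) ≤ 3 := card_le_three
    omega
  simp only [mem_sdiff, mem_insert, mem_singleton, not_or] at ht
  have hRt := hs x hx t ht.1 (h.ne_left hR).symm (Ne.symm ht.2.1) (Ne.symm ht.2.2.1)
  exact ht.2.2.2 (h.unique hR hRt).symm

theorem inCount_eq_zero {u : ℕ} (hd : IsDominant R V u) : inCount R V u = 0 :=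
  sum_eq_zero fun x hx => sum_eq_zero fun z hz => if_neg (hd x hx z hz)

/-- Pointed triples are dropped one at a time, each lowering the count by 2. This lets the induction
work with a relation of exactly the extremal size before the upper bound is known. -/
theorem exists_subrelation (h : IndepRel R) (V : Finset ℕ) (m : ℕ) (hm : 2 * m ≤ count R V) :
    ∃ R' : ℕ → ℕ → ℕ → Prop, IndepRel R' ∧ (∀ x y z, R' x y z → R x y z) ∧
      count R' V = 2 * m := by
  obtain ⟨k, hk⟩ : ∃ k, count R V = 2 * m + 2 * k := by
    obtain ⟨c, hc⟩ := even_count h V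
    exact ⟨c - m, by omega⟩
  induction k generalizing R with
  | zero => exact ⟨R, h, fun _ _ _ => id, hk⟩
  | succ k ih =>
    obtain ⟨x, hx, hx0⟩ : ∃ x ∈ V, outCount R V x ≠ 0 := by
      by_contra! hc
      rw [count, sum_eq_zero hc] at hk
      omega
    obtain ⟨y, hy, hy0⟩ : ∃ y ∈ V, (∑ z ∈ V, if R x y z then 1 else 0) ≠ 0 := by
      by_contra! hc
      exact hx0 (sum_eq_zero hc)
    obtain ⟨z, hz, hz0⟩ : ∃ z ∈ V, R x y z := by
      by_contra! hc
      exact hy0 (sum_eq_zero fun z hz => if_neg (hc z hz))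
    let R' : ℕ → ℕ → ℕ → Prop := fun a b c =>
      R a b c ∧ ¬ (a = x ∧ (b = y ∧ c = z ∨ b = z ∧ c = y))
    have h' : IndepRel R' :=
      ⟨fun ⟨h1, h2⟩ => ⟨h.symm h1, by tauto⟩, fun h1 => h.ne_left h1.1, fun h1 => h.ne h1.1,
        fun h1 h2 => h.unique h1.1 h2.1⟩
    have hne : y ≠ z := h.ne hz0
    have key : count R V = count R' V + 2 := by
      have hi : ∀ a b c, (if R a b c then 1 else 0) = (if R' a b c then 1 else 0)
          + ((if a = x then if b = y then if c = z then 1 else 0 else 0 else 0)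
          + (if a = x then if b = z then if c = y then 1 else 0 else 0 else 0)) := by
        intro a b c
        have hz1 := h.symm hz0
        by_cases ha : a = x <;> by_cases hb : b = y <;> by_cases hc : c = z <;>
          by_cases hb' : b = z <;> by_cases hc' : c = y <;> simp_all [R']
      simp only [count, outCount, hi, sum_add_distrib, sum_ite_eq', sum_ite_irrel, sum_const_zero,
        hx, hy, hz, if_true]
      congr!
    obtain ⟨R'', h1, h2, h3⟩ := ih h' (by omega) (by omega)
    exact ⟨R'', h1, fun a b c habc => (h2 a b c habc).1, h3⟩

end IndepRel

/-! ### Out-neighbours and mutual neighbours -/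

namespace IndepRel

open Finset
open scoped Classical

variable {R : ℕ → ℕ → ℕ → Prop} {V : Finset ℕ}

/-- Some triple pointed at `u` contains `v`. -/
def Reach (R : ℕ → ℕ → ℕ → Prop) (V : Finset ℕ) (u v : ℕ) : Prop := ∃ z ∈ V, R u v z

/-- The out-neighbours of `u`: those reached by `u` that do not reach `u`, where pairs without
any relation are oriented by the order of `ℕ`. -/
noncomputable def outNbr (R : ℕ → ℕ → ℕ → Prop) (V : Finset ℕ) (u : ℕ) : Finset ℕ :=
  {v ∈ V | v ≠ u ∧ ¬ Reach R V v u ∧ (Reach R V u v ∨ u < v)}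

/-- The vertices that reach `u` and are reached by `u`. -/
noncomputable def mutualNbr (R : ℕ → ℕ → ℕ → Prop) (V : Finset ℕ) (u : ℕ) : Finset ℕ :=
  {v ∈ V | Reach R V u v ∧ Reach R V v u}

theorem notMem_outNbr_self {u : ℕ} : u ∉ outNbr R V u := by simp [outNbr]

theorem mutualNbr_comm {u v : ℕ} (hu : u ∈ V) (hv : v ∈ V) :
    v ∈ mutualNbr R V u ↔ u ∈ mutualNbr R V v := by
  simp only [mutualNbr, mem_filter, hu, hv, true_and, and_comm]

theorem mutualNbr_irrefl (h : IndepRel R) {u : ℕ} : u ∉ mutualNbr R V u := by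
  intro hu
  obtain ⟨z, -, hz⟩ := (mem_filter.1 hu).2.1
  exact h.not_self_left hz

theorem indicator_trichotomy (h : IndepRel R) {u v : ℕ} (hu : u ∈ V) (hv : v ∈ V) :
    (if v ∈ outNbr R V u then 1 else 0) + (if u ∈ outNbr R V v then 1 else 0)
      + (if v ∈ mutualNbr R V u then 1 else 0) = if u ≠ v then 1 else 0 := by
  by_cases huv : u = v
  · subst huv
    simp [notMem_outNbr_self, mutualNbr_irrefl h]
  · have hvu : v ≠ u := fun e => huv e.symm
    rcases lt_or_gt_of_ne huv with hlt | hlt <;>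
      by_cases h1 : Reach R V u v <;> by_cases h2 : Reach R V v u <;>
      simp [outNbr, mutualNbr, hu, hv, huv, hvu, h1, h2, hlt, hlt.not_gt]

theorem trichotomy (h : IndepRel R) {u v : ℕ} (hu : u ∈ V) (hv : v ∈ V) (huv : u ≠ v) :
    v ∈ outNbr R V u ∨ u ∈ outNbr R V v ∨ v ∈ mutualNbr R V u := by
  have := indicator_trichotomy h hu hv
  by_contra! hc
  simp [hc, huv] at this

/-- Every unordered pair contributes 2, either as one arc of weight 2 or as a mutual pair seen from
both ends. Orienting the unrelated pairs as well makes this an equality. -/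
theorem sum_card_nbr (h : IndepRel R) (V : Finset ℕ) :
    ∑ u ∈ V, (2 * #(outNbr R V u) + #(mutualNbr R V u)) = #V * (#V - 1) := by
  have hd : ∀ u, #(outNbr R V u) = ∑ v ∈ V, if v ∈ outNbr R V u then 1 else 0 := fun u => by
    rw [sum_boole, Nat.cast_id, filter_mem_eq_inter]
    exact congrArg card (inter_eq_right.2 (filter_subset _ _)).symm
  have hs : ∀ u, #(mutualNbr R V u) = ∑ v ∈ V, if v ∈ mutualNbr R V u then 1 else 0 := fun u => by
    rw [sum_boole, Nat.cast_id, filter_mem_eq_inter]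
    exact congrArg card (inter_eq_right.2 (filter_subset _ _)).symm
  have h1 : ∑ u ∈ V, #(outNbr R V u) = ∑ u ∈ V, ∑ v ∈ V, if u ∈ outNbr R V v then 1 else 0 := by
    simp only [hd]
    exact sum_comm
  have h2 : ∑ u ∈ V, ∑ v ∈ V, (if u ≠ v then 1 else 0) = #V * (#V - 1) := by
    rw [← smul_eq_mul, ← sum_const]
    refine sum_congr rfl fun u hu => ?_
    rw [sum_boole, Nat.cast_id, filter_ne, card_erase_of_mem hu]
  rw [← h2, sum_add_distrib, ← mul_sum, two_mul]
  conv_lhs => enter [1, 2]; rw [h1]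
  simp only [hd, hs, ← sum_add_distrib]
  exact sum_congr rfl fun u hu => sum_congr rfl fun v hv => indicator_trichotomy h hu hv

theorem mem_nbr_of_rel (h : IndepRel R) {u y z : ℕ} (hy : y ∈ V) (hz : z ∈ V) (hR : R u y z) :
    y ∈ outNbr R V u ∨ y ∈ mutualNbr R V u := by
  have h1 : Reach R V u y := ⟨z, hz, hR⟩
  have := h.ne_left hR
  simp only [outNbr, mutualNbr, mem_filter, hy, h1, true_and, true_or, and_true]
  tauto

/-- Since `R y u t` for some `t`, every partner of `y` at `u` equals `t`. A mutual neighbour thus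
has at most one partner, so it accounts for at most one pair in each order. -/
theorem eq_of_mem_mutualNbr (h : IndepRel R) {u y z z' : ℕ} (hy : y ∈ mutualNbr R V u)
    (hz : R u y z) (hz' : R u y z') : z = z' := by
  obtain ⟨-, -, t, -, ht⟩ := mem_filter.1 hy
  rw [h.unique hz ht, h.unique hz' ht]

theorem card_mutual_fst_le (h : IndepRel R) (V : Finset ℕ) (u : ℕ) :
    #{p ∈ V ×ˢ V | R u p.1 p.2 ∧ p.1 ∈ mutualNbr R V u} ≤ #(mutualNbr R V u) := by
  refine card_le_card_of_injOn Prod.fst (fun p hp => ?_) ?_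
  · exact (mem_filter.1 hp).2.2
  · rintro ⟨y, z⟩ hp ⟨y', z'⟩ hp' (rfl : y = y')
    have hp := mem_filter.1 hp
    have hp' := mem_filter.1 hp'
    exact congrArg (Prod.mk y) (eq_of_mem_mutualNbr h hp.2.2 hp.2.1 hp'.2.1)

theorem card_mutual_snd_le (h : IndepRel R) (V : Finset ℕ) (u : ℕ) :
    #{p ∈ V ×ˢ V | R u p.1 p.2 ∧ p.2 ∈ mutualNbr R V u} ≤ #(mutualNbr R V u) := by
  refine card_le_card_of_injOn Prod.snd (fun p hp => ?_) ?_
  · exact (mem_filter.1 hp).2.2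
  · rintro ⟨y, z⟩ hp ⟨y', z'⟩ hp' (rfl : z = z')
    have hp := mem_filter.1 hp
    have hp' := mem_filter.1 hp'
    exact congrArg (·, z) (eq_of_mem_mutualNbr h hp.2.2 (h.symm hp.2.1) (h.symm hp'.2.1))

theorem outCount_le_nbr (h : IndepRel R) (V : Finset ℕ) (u : ℕ) :
    outCount R V u
      ≤ #(outNbr R V u) * (#(outNbr R V u) - 1) + 2 * #(mutualNbr R V u) := by
  rw [outCount_eq_card]
  have hsub : {p ∈ V ×ˢ V | R u p.1 p.2} ⊆ (outNbr R V u).offDiag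
      ∪ ({p ∈ V ×ˢ V | R u p.1 p.2 ∧ p.1 ∈ mutualNbr R V u}
      ∪ {p ∈ V ×ˢ V | R u p.1 p.2 ∧ p.2 ∈ mutualNbr R V u}) := by
    rintro ⟨y, z⟩ hp
    simp only [mem_filter, mem_product] at hp
    have h1 := mem_nbr_of_rel h hp.1.1 hp.1.2 hp.2
    have h2 := mem_nbr_of_rel h hp.1.2 hp.1.1 (h.symm hp.2)
    have h3 := h.ne hp.2
    simp only [mem_union, mem_offDiag, mem_filter, mem_product]
    tauto
  have h1 := card_mutual_fst_le h V u
  have h2 := card_mutual_snd_le h V u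
  have h3 := card_le_card hsub
  have h4 := card_union_le (outNbr R V u).offDiag
      ({p ∈ V ×ˢ V | R u p.1 p.2 ∧ p.1 ∈ mutualNbr R V u}
      ∪ {p ∈ V ×ˢ V | R u p.1 p.2 ∧ p.2 ∈ mutualNbr R V u})
  have h5 := card_union_le ({p ∈ V ×ˢ V | R u p.1 p.2 ∧ p.1 ∈ mutualNbr R V u})
      {p ∈ V ×ˢ V | R u p.1 p.2 ∧ p.2 ∈ mutualNbr R V u}
  rw [offDiag_card, ← Nat.mul_sub_one] at h4
  omega

/-- Both members of each pair at `u` are now mutual neighbours, so the first one alone determines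
the pair. -/
theorem outCount_le_of_outNbr_eq_empty (h : IndepRel R) {u : ℕ} (hd : outNbr R V u = ∅) :
    outCount R V u ≤ #(mutualNbr R V u) ∧ (#(mutualNbr R V u) ≤ 1 → outCount R V u = 0) := by
  have hm : ∀ y ∈ V, ∀ z ∈ V, R u y z → y ∈ mutualNbr R V u := fun y hy z hz hR => by
    simpa [hd] using mem_nbr_of_rel h hy hz hR
  constructor
  · rw [outCount_eq_card]
    refine le_trans (card_le_card fun p hp => ?_) (card_mutual_fst_le h V u)
    simp only [mem_filter, mem_product] at hp ⊢
    exact ⟨hp.1, hp.2, hm _ hp.1.1 _ hp.1.2 hp.2⟩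
  · intro hs
    refine sum_eq_zero fun y hy => sum_eq_zero fun z hz => if_neg fun hR => ?_
    exact h.ne hR (card_le_one.1 hs _ (hm y hy z hz hR) _ (hm z hz y hy (h.symm hR)))

/-- The surplus that a vertex without out-neighbours and with `s` mutual neighbours may have. -/
def surplus (s : ℕ) : ℕ := if s = 0 then 4 else if s = 1 then 2 else 4 - s

theorem surplus_antitone : Antitone surplus := by
  intro a b hab
  simp only [surplus]
  split_ifs <;> omega

theorem card_outNbr_lt (h : IndepRel R) {u : ℕ} (hu : u ∈ V) (hd : ¬ IsDominant R V u) :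
    #(outNbr R V u) + 2 ≤ #V := by
  simp only [IsDominant, not_forall, not_not] at hd
  obtain ⟨x, hx, z, hz, hR⟩ := hd
  have hsub : outNbr R V u ⊆ (V.erase u).erase x := by
    intro v hv
    simp only [outNbr, mem_filter] at hv
    simp only [mem_erase]
    refine ⟨?_, hv.2.1, hv.1⟩
    rintro rfl
    exact hv.2.2.1 ⟨z, hz, hR⟩
  have := card_le_card hsub
  rw [card_erase_of_mem (by simp [hx, h.ne_left hR]), card_erase_of_mem hu] at this
  have : 2 ≤ #V := by
    have := card_le_card (s := {x, u}) (t := V) (by simp [insert_subset_iff, hx, hu])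
    rwa [card_pair (h.ne_left hR)] at this
  omega

/-- With `d` out-neighbours and `d ≥ 1` the claim reduces to `d(d-1) + 4 ≤ 4d`, that is `(d-1)(d-4)
≤ 0`. Non-dominance gives `d ≤ #V - 2 ≤ 4`. For `d = 0` the function `surplus` covers the deficit.
-/
theorem outCount_add_four_le (h : IndepRel R) (hV : #V ≤ 6) {u : ℕ} (hu : u ∈ V)
    (hd : ¬ IsDominant R V u) :
    outCount R V u + 4 ≤ 2 * (2 * #(outNbr R V u) + #(mutualNbr R V u))
      + if outNbr R V u = ∅ then surplus #(mutualNbr R V u) else 0 := by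
  have h1 := card_outNbr_lt h hu hd
  have h2 := outCount_le_nbr h V u
  split_ifs with h0
  · obtain ⟨h3, h4⟩ := outCount_le_of_outNbr_eq_empty h h0
    simp only [surplus, h0, card_empty]
    split_ifs <;> omega
  · rw [← card_eq_zero] at h0
    generalize #(outNbr R V u) = d at *
    have : d ≤ 4 := by omega
    interval_cases d <;> omega

/-- Equality needs `(d-1)(d-4) = 0`, and here `d ≤ 3`. -/
theorem outNbr_card_eq_one (h : IndepRel R) (hV : #V ≤ 5) {u : ℕ} (hu : u ∈ V)
    (hd : ¬ IsDominant R V u) (h0 : outNbr R V u ≠ ∅)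
    (heq : 2 * (2 * #(outNbr R V u) + #(mutualNbr R V u)) ≤ outCount R V u + 4) :
    #(outNbr R V u) = 1 := by
  have h1 := card_outNbr_lt h hu hd
  have h2 := outCount_le_nbr h V u
  rw [Ne, ← card_eq_zero] at h0
  generalize #(outNbr R V u) = d at *
  have : d ≤ 3 := by omega
  interval_cases d <;> omega

theorem sum_outCount_le (h : IndepRel R) (hV : #V ≤ 6) (hd : ∀ u ∈ V, ¬ IsDominant R V u) :
    count R V + 4 * #V ≤ 2 * (#V * (#V - 1))
      + ∑ u ∈ V with outNbr R V u = ∅, surplus #(mutualNbr R V u) := by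
  have := sum_le_sum fun u hu => outCount_add_four_le h hV hu (hd u hu)
  rw [sum_add_distrib, sum_add_distrib, ← mul_sum, sum_card_nbr h, sum_const, smul_eq_mul,
    ← sum_filter] at this
  rw [count]
  omega

theorem card_sinks_le (h : IndepRel R) {u : ℕ} (hu : u ∈ V) (h0 : outNbr R V u = ∅) :
    #{u ∈ V | outNbr R V u = ∅} - 1 ≤ #(mutualNbr R V u) := by
  rw [← card_erase_of_mem (a := u) (by simp [hu, h0])]
  refine card_le_card fun v hv => ?_
  simp only [mem_erase, mem_filter] at hv
  have := trichotomy h hu hv.2.1 hv.1.symm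
  simpa [h0, hv.2.2] using this

/-- The `k` vertices without out-neighbours are pairwise mutual, so the sum is at most `k * surplus
(k - 1)`. This is largest at `k = 3`. -/
theorem sum_surplus_le (h : IndepRel R) (hV : #V ≤ 6) :
    ∑ u ∈ V with outNbr R V u = ∅, surplus #(mutualNbr R V u) ≤ 6 := by
  have h1 : ∑ u ∈ V with outNbr R V u = ∅, surplus #(mutualNbr R V u)
      ≤ #{u ∈ V | outNbr R V u = ∅} • surplus (#{u ∈ V | outNbr R V u = ∅} - 1) := by
    refine sum_le_card_nsmul _ _ _ fun u hu => surplus_antitone ?_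
    rw [mem_filter] at hu
    exact card_sinks_le h hu.1 hu.2
  refine h1.trans ?_
  have h2 : #{u ∈ V | outNbr R V u = ∅} ≤ 6 := (card_filter_le _ _).trans hV
  generalize #{u ∈ V | outNbr R V u = ∅} = k at *
  interval_cases k <;> simp [surplus]

/-- The two sinks are mutual, and `unique` gives them a common third element `z`. As `u` has no
out-neighbours, `z` is mutual to `u` too, which supplies the triple pointed at `z`. -/
theorem exists_full_triple (h : IndepRel R) {u v : ℕ} (hu : u ∈ V) (hv : v ∈ V) (huv : u ≠ v)
    (hu0 : outNbr R V u = ∅) (hv0 : outNbr R V v = ∅) :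
    ∃ z ∈ V, R u v z ∧ R v u z ∧ R z u v := by
  have hm : v ∈ mutualNbr R V u := by simpa [hu0, hv0] using trichotomy h hu hv huv
  obtain ⟨-, ⟨z, hz, hR⟩, t, ht, hRt⟩ := mem_filter.1 hm
  obtain rfl := h.unique hR hRt
  refine ⟨z, hz, hR, hRt, ?_⟩
  have hzm : z ∈ mutualNbr R V u := by
    simpa [hu0] using mem_nbr_of_rel h hz hv (h.symm hR)
  obtain ⟨-, -, s, hs, hRs⟩ := mem_filter.1 hzm
  rwa [← h.unique (h.symm hR) hRs] at hRs

end IndepRel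

/-! ### Triples pointed at all three members -/

namespace IndepRel

open Finset
open scoped Classical

variable {R : ℕ → ℕ → ℕ → Prop} {V : Finset ℕ}

theorem indicator_le (P : Prop) : (if P then 1 else 0) ≤ 1 := by
  split_ifs <;> simp

theorem indicator_add_le {P Q : Prop} (hPQ : ¬ (P ∧ Q)) :
    (if P then 1 else 0) + (if Q then 1 else 0) ≤ 1 := by
  by_cases hP : P
  · simpa [hP] using fun hQ => hPQ ⟨hP, hQ⟩
  · simpa [hP] using indicator_le Q

theorem mem_of_full_triple (h : IndepRel R) {a b c : ℕ} (ha : R a b c) (hb : R b a c)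
    (hc : R c a b) {t s w : ℕ} (ht : t ∈ ({a, b, c} : Finset ℕ)) (hs : s ∈ ({a, b, c} : Finset ℕ))
    (hR : R t s w) : w ∈ ({a, b, c} : Finset ℕ) := by
  have hts := h.ne_left hR
  simp only [mem_insert, mem_singleton] at ht hs ⊢
  rcases ht with rfl | rfl | rfl <;> rcases hs with rfl | rfl | rfl
  · exact absurd rfl hts
  · exact Or.inr (Or.inr (h.unique hR hb))
  · exact Or.inr (Or.inl (h.unique hR hc))
  · exact Or.inr (Or.inr (h.unique hR ha))
  · exact absurd rfl hts
  · exact Or.inl (h.unique hR (h.symm hc))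
  · exact Or.inr (Or.inl (h.unique hR (h.symm ha)))
  · exact Or.inl (h.unique hR (h.symm hb))
  · exact absurd rfl hts

theorem card_full_triple (h : IndepRel R) {a b c : ℕ} (ha : R a b c) :
    #({a, b, c} : Finset ℕ) = 3 :=
  card_eq_three.2 ⟨a, b, c, h.ne_left ha, h.ne_right ha, h.ne ha, rfl⟩

theorem exists_dominant_of_full_triple (h : IndepRel R) {a b c : ℕ} (ha : R a b c) (hb : R b a c)
    (hc : R c a b) (hsub : {a, b, c} ⊆ V) (hV : #V = 4) : ∃ x ∈ V, IsDominant R V x := by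
  obtain ⟨x, hx⟩ := card_eq_one.1 (by
    rw [card_sdiff_of_subset hsub, hV, card_full_triple h ha] : #(V \ {a, b, c}) = 1)
  have hxm : x ∈ V \ {a, b, c} := by simp [hx]
  rw [mem_sdiff] at hxm
  have hcov : ∀ t ∈ V, t ≠ x → t ∈ ({a, b, c} : Finset ℕ) := fun t ht htx => by
    by_contra hc
    exact htx (by simpa [hx] using mem_sdiff.2 ⟨ht, hc⟩)
  refine ⟨x, hxm.1, fun t ht s hs hR => hxm.2 ?_⟩
  exact mem_of_full_triple h ha hb hc (hcov t ht (h.ne_left hR)) (hcov s hs (h.ne hR).symm)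
    (h.symm hR)

/-- Let `T = {a, b, c}` and let `x, y` be the other two elements. A triple pointed in `T` lies
inside `T` or is `(t, {x, y})`. In both cases below at most 11 unordered pointed triples remain. -/
theorem count_le_of_full_triple (h : IndepRel R) {a b c : ℕ} (ha : R a b c) (hb : R b a c)
    (hc : R c a b) (hsub : {a, b, c} ⊆ V) (hV : #V = 5) (hd : ∀ x ∈ V, ¬ IsDominant R V x) :
    count R V ≤ 22 := by
  have h3 := card_full_triple h ha
  obtain ⟨x, y, hxy, hx⟩ := card_eq_two.1 (by
    rw [card_sdiff_of_subset hsub, hV, h3] : #(V \ {a, b, c}) = 2)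
  have hxm : x ∈ V \ {a, b, c} := by simp [hx]
  have hym : y ∈ V \ {a, b, c} := by simp [hx]
  obtain ⟨hxV, hxT⟩ := mem_sdiff.1 hxm
  obtain ⟨hyV, hyT⟩ := mem_sdiff.1 hym
  have hab := h.ne_left ha
  have hac := h.ne_right ha
  have hbc := h.ne ha
  have hVeq : V = insert y (insert x {a, b, c}) := by
    rw [← sdiff_union_of_subset hsub, hx]
    ext t
    simp only [mem_union, mem_insert, mem_singleton]
    tauto
  have hyx : y ∉ insert x ({a, b, c} : Finset ℕ) := fun hm =>
    (mem_insert.1 hm).elim hxy.symm hyT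
  have hcl : ∀ w, w ∉ ({a, b, c} : Finset ℕ) → ∀ t ∈ ({a, b, c} : Finset ℕ),
      ∀ s ∈ ({a, b, c} : Finset ℕ), ¬ R t w s := fun w hw t ht s hs hR =>
    hw (mem_of_full_triple h ha hb hc ht hs (h.symm hR))
  have hT : count R {a, b, c} ≤ 6 := by
    refine (sum_le_card_nsmul _ _ 2 fun t ht => ?_).trans_eq (by rw [h3]; rfl)
    exact (outCount_le h ht).trans_eq (by rw [h3])
  have hsum : ∀ f : ℕ → ℕ, ∑ t ∈ ({a, b, c} : Finset ℕ), f t = f a + f b + f c := fun f => by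
    have h1 : a ∉ ({b, c} : Finset ℕ) := by simp [hab, hac]
    have h2 : b ∉ ({c} : Finset ℕ) := by simp [hbc]
    rw [sum_insert h1, sum_insert h2, sum_singleton, add_assoc]
  have hout : ∀ w, outCount R {a, b, c} w = 2 * ((if R w a b then 1 else 0)
      + (if R w a c then 1 else 0) + if R w b c then 1 else 0) := by
    intro w
    have e1 : R w b a ↔ R w a b := h.comm
    have e2 : R w c a ↔ R w a c := h.comm
    have e3 : R w c b ↔ R w b c := h.comm
    simp only [outCount, hsum, h.not_self, if_false, e1, e2, e3]
    ring
  have hin : ∀ w, w ∉ ({a, b, c} : Finset ℕ) → inCount R {a, b, c} w = 0 := fun w hw =>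
    sum_eq_zero fun t ht => sum_eq_zero fun s hs => if_neg (hcl w hw t ht s hs)
  have hin2 : inCount R (insert x {a, b, c}) y = (∑ t ∈ ({a, b, c} : Finset ℕ),
      if R x y t then 1 else 0) + ∑ t ∈ ({a, b, c} : Finset ℕ), if R t x y then 1 else 0 := by
    have := hin y hyT
    simp only [inCount] at this
    have h1 : ¬ R x x y := h.not_self_left
    simp only [inCount, sum_insert hxT, sum_add_distrib, this, if_false, zero_add, add_zero,
      h.comm (y := y) (z := x), h1]
  have hdx := hd x hxV
  have hdy := hd y hyV
  have hcov : ∀ t ∈ V, t = x ∨ t = y ∨ t ∈ ({a, b, c} : Finset ℕ) := fun t ht => by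
    rw [hVeq] at ht
    simp only [mem_insert] at ht ⊢
    tauto
  have hdom : ∀ u v, u ∉ ({a, b, c} : Finset ℕ) →
      (∀ t ∈ V, t = u ∨ t = v ∨ t ∈ ({a, b, c} : Finset ℕ)) → ¬ IsDominant R V u →
      ∃ t ∈ ({a, b, c} : Finset ℕ), R v u t ∨ R t u v := by
    intro u v hu hcv hnd
    simp only [IsDominant, not_forall, not_not] at hnd
    obtain ⟨t, ht, s, hs, hR⟩ := hnd
    rcases hcv t ht with rfl | rfl | htT
    · exact absurd rfl (h.ne_left hR)
    · rcases hcv s hs with rfl | rfl | hsT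
      · exact absurd rfl (h.ne hR)
      · exact absurd rfl (h.ne_right hR)
      · exact ⟨s, hsT, Or.inl hR⟩
    · rcases hcv s hs with rfl | rfl | hsT
      · exact absurd rfl (h.ne hR)
      · exact ⟨t, htT, Or.inr hR⟩
      · exact absurd hR (hcl u hu t htT s hsT)
  have hdx' := hdom x y hxT hcov hdx
  have hdy' := hdom y x hyT (fun t ht => by have := hcov t ht; tauto) hdy
  have hj : ∀ u v, v ∉ ({a, b, c} : Finset ℕ) → ∀ t ∈ ({a, b, c} : Finset ℕ), R t u v →
      ∀ s ∈ ({a, b, c} : Finset ℕ), ¬ R u t s := fun u v hv t ht hR s hs hR' =>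
    hv (h.unique hR hR' ▸ hs)
  rw [hVeq, count_insert h hyx, count_insert h hxT, hin x hxT, outCount_insert h hxT, hin2, hout,
    hout, hsum, hsum, hsum]
  have hmem : ∀ t, t ∈ ({a, b, c} : Finset ℕ) ↔ t = a ∨ t = b ∨ t = c := by simp
  simp only [hmem] at hdx' hdy' hj hxT hyT
  have hjx := fun t ht (hR : R t x y) => hj x y hyT t ht hR
  have hjy := fun t ht (hR : R t x y) => hj y x hxT t ht (h.symm hR)
  -- `R y x t` and `R x y s` force `t = s`. Hence there are at most 3 such triples in total, and
  -- exactly one of each kind if both kinds occur.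
  have pq : ∀ t s, t ≠ s → (if R y x t then 1 else 0) + (if R x y s then 1 else 0) ≤ 1 :=
    fun t s hts => indicator_add_le fun hc => hts (h.unique hc.1 hc.2)
  have p1 := pq a b hab
  have p2 := pq a c hac
  have p3 := pq b a hab.symm
  have p4 := pq b c hbc
  have p5 := pq c a hac.symm
  have p6 := pq c b hbc.symm
  -- If some `(t, {x, y})` is present, no triple at `x` or `y` has its pair in `T` and contains `t`,
  -- so each has at most one with pair in `T`: 3 + 1 + 1 + 3 + 3. Otherwise non-dominance of `x` and
  -- `y` makes both mixed kinds occur: 3 + 3 + 3 + 1 + 1.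
  by_cases hjj : R a x y ∨ R b x y ∨ R c x y
  · have hbd : ∀ w, (∀ t, t = a ∨ t = b ∨ t = c → R t x y →
        ∀ s, s = a ∨ s = b ∨ s = c → ¬ R w t s) → ((if R w a b then 1 else 0)
      + (if R w a c then 1 else 0) + if R w b c then 1 else 0) ≤ 1 := by
      intro w hw
      have e1 : R w b a ↔ R w a b := h.comm
      have e2 : R w c a ↔ R w a c := h.comm
      have e3 : R w c b ↔ R w b c := h.comm
      rcases hjj with hjj | hjj | hjj
      · have g1 := hw a (by simp) hjj b (by simp)
        have g2 := hw a (by simp) hjj c (by simp)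
        simpa [g1, g2] using indicator_le _
      · have g1 := hw b (by simp) hjj a (by simp)
        have g2 := hw b (by simp) hjj c (by simp)
        rw [e1] at g1
        simpa [g1, g2] using indicator_le _
      · have g1 := hw c (by simp) hjj a (by simp)
        have g2 := hw c (by simp) hjj b (by simp)
        rw [e2] at g1
        rw [e3] at g2
        simpa [g1, g2] using indicator_le _
    have b1 := hbd x hjx
    have b2 := hbd y hjy
    have j1 := indicator_le (R a x y)
    have j2 := indicator_le (R b x y)
    have j3 := indicator_le (R c x y)
    omega
  · simp only [not_or] at hjj
    have hp : 1 ≤ (if R y x a then 1 else 0) + (if R y x b then 1 else 0)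
        + (if R y x c then 1 else 0) := by
      obtain ⟨t, rfl | rfl | rfl, h1 | h1⟩ := hdx'
      on_goal 2 => exact absurd h1 hjj.1
      on_goal 3 => exact absurd h1 hjj.2.1
      on_goal 4 => exact absurd h1 hjj.2.2
      all_goals simp only [h1, if_true]; omega
    have hq : 1 ≤ (if R x y a then 1 else 0) + (if R x y b then 1 else 0)
        + (if R x y c then 1 else 0) := by
      obtain ⟨t, rfl | rfl | rfl, h1 | h1⟩ := hdy'
      on_goal 2 => exact absurd (h.symm h1) hjj.1
      on_goal 3 => exact absurd (h.symm h1) hjj.2.1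
      on_goal 4 => exact absurd (h.symm h1) hjj.2.2
      all_goals simp only [h1, if_true]; omega
    simp only [hjj, if_false]
    have l1 := indicator_le (R x a b)
    have l2 := indicator_le (R x a c)
    have l3 := indicator_le (R x b c)
    have l4 := indicator_le (R y a b)
    have l5 := indicator_le (R y a c)
    have l6 := indicator_le (R y b c)
    have l7 := indicator_le (R x y a)
    have l8 := indicator_le (R x y b)
    have l9 := indicator_le (R x y c)
    have m7 := indicator_le (R y x a)
    have m8 := indicator_le (R y x b)
    have m9 := indicator_le (R y x c)
    omega

end IndepRel

/-! ### The extremal relations and their models -/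

namespace IndepRel

open Finset
open scoped Classical

variable {R : ℕ → ℕ → ℕ → Prop} {V : Finset ℕ}

/-- The triples pointed at their largest element, if that is at least `k`, together with the pointed
triples `(x, {y, z})` of numbers less than `k` such that `C y z`. -/
def chainRel (k : ℕ) (C : ℕ → ℕ → Prop) (x y z : ℕ) : Prop :=
  (x ≠ y ∧ x ≠ z ∧ y ≠ z) ∧ ((k ≤ x ∧ y < x ∧ z < x) ∨ (x < k ∧ y < k ∧ z < k ∧ C y z))

/-- The relation `chainRel` in which `0, 1, 2` form a triple with all three points. -/
def triangleRel : ℕ → ℕ → ℕ → Prop := chainRel 3 fun _ _ => True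

/-- The relation `chainRel` for the triples of numbers less than `k` that contain `0` and are not
pointed at `0`. -/
def apexRel (k : ℕ) : ℕ → ℕ → ℕ → Prop := chainRel k fun y z => y = 0 ∨ z = 0

/-- The restriction of `R` to `V` is isomorphic to the restriction of `S` to `0, …, #V - 1`. -/
def IsModel (S R : ℕ → ℕ → ℕ → Prop) (V : Finset ℕ) : Prop :=
  ∃ g : ℕ → ℕ, Set.BijOn g (range #V) V ∧
    ∀ x < #V, ∀ y < #V, ∀ z < #V, (R (g x) (g y) (g z) ↔ S x y z)

/-- The restriction of `R` to `V` is isomorphic to one of the three extremal relations. -/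
def IsExtremal (R : ℕ → ℕ → ℕ → Prop) (V : Finset ℕ) : Prop :=
  IsModel triangleRel R V ∨ (4 ≤ #V ∧ IsModel (apexRel 4) R V) ∨ (5 ≤ #V ∧ IsModel (apexRel 5) R V)

theorem bijOn_update {g : ℕ → ℕ} {m w : ℕ} (hg : Set.BijOn g (range m) V) (hw : w ∉ V) :
    Set.BijOn (Function.update g m w) (range (m + 1)) (insert w V : Finset ℕ) := by
  have h1 : Set.BijOn (Function.update g m w) (range m) V := hg.congr fun x hx => by
    rw [Function.update_of_ne]
    exact (mem_range.1 hx).ne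
  have h2 := h1.insert (a := m) (by simpa using hw)
  rw [Function.update_self] at h2
  rwa [range_add_one, coe_insert, coe_insert]

theorem exists_bijOn (V : Finset ℕ) : ∃ g : ℕ → ℕ, Set.BijOn g (range #V) V := by
  induction V using Finset.induction_on with
  | empty => exact ⟨id, by simp⟩
  | insert w V hw ih =>
    obtain ⟨g, hg⟩ := ih
    exact ⟨_, by rw [card_insert_of_notMem hw]; exact bijOn_update hg hw⟩

theorem exists_bijOn_zero {o : ℕ} (ho : o ∈ V) :
    ∃ g : ℕ → ℕ, Set.BijOn g (range #V) V ∧ g 0 = o := by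
  obtain ⟨g, hg⟩ := exists_bijOn V
  obtain ⟨i, hi, hio⟩ := hg.surjOn ho
  have h0 : 0 ∈ (range #V : Set ℕ) := by
    rw [mem_coe, mem_range, card_pos]
    exact ⟨o, ho⟩
  exact ⟨g ∘ Equiv.swap 0 i, hg.comp (Equiv.bijOn_swap h0 hi), by simpa using hio⟩

/-- The source receives the new top label `m`. Since `k ≤ m`, `chainRel` points every triple
containing `m` at `m`, and dominance excludes all others. -/
theorem IsModel.of_erase_source (h : IndepRel R) {w k : ℕ} {C : ℕ → ℕ → Prop} (hw : w ∈ V)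
    (hV : 4 ≤ #V) (hs : IsSource R V w) (hk : k ≤ #(V.erase w))
    (hm : IsModel (chainRel k C) R (V.erase w)) : IsModel (chainRel k C) R V := by
  obtain ⟨g, hg, hR⟩ := hm
  have hdom := hs.isDominant h hV
  generalize hmdef : #(V.erase w) = m at *
  have hVm : #V = m + 1 := by rw [← card_erase_add_one hw, hmdef]
  have hb := bijOn_update hg (notMem_erase w V)
  rw [insert_erase hw] at hb
  rw [← hVm] at hb
  refine ⟨_, hb, ?_⟩
  rw [hVm]
  have hmem : ∀ x < m + 1, Function.update g m w x ∈ V := fun x hx =>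
    hb.mapsTo (by simpa [hVm] using hx)
  have hinj : ∀ x < m + 1, ∀ y < m + 1, x ≠ y →
      Function.update g m w x ≠ Function.update g m w y := fun x hx y hy hxy he =>
    hxy (hb.injOn (by simpa [hVm] using hx) (by simpa [hVm] using hy) he)
  have hgm : Function.update g m w m = w := Function.update_self ..
  have hglt : ∀ x < m, Function.update g m w x = g x := fun x hx =>
    Function.update_of_ne hx.ne _ _
  intro x hx y hy z hz
  by_cases hne : x ≠ y ∧ x ≠ z ∧ y ≠ z
  swap
  · refine iff_of_false (fun hc => hne ⟨?_, ?_, ?_⟩) fun hc => hne hc.1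
    · rintro rfl; exact h.not_self_left hc
    · rintro rfl; exact h.not_self_right hc
    · rintro rfl; exact h.not_self hc
  obtain ⟨hxy, hxz, hyz⟩ := hne
  rcases (Nat.lt_succ_iff_lt_or_eq.1 hx) with hx' | rfl
  · rcases (Nat.lt_succ_iff_lt_or_eq.1 hy) with hy' | rfl
    · rcases (Nat.lt_succ_iff_lt_or_eq.1 hz) with hz' | rfl
      · rw [hglt x hx', hglt y hy', hglt z hz', hR x hx' y hy' z hz']
      · refine iff_of_false (fun hc => ?_) fun hc => ?_
        · rw [hgm] at hc
          exact hdom _ (hmem x hx) _ (hmem y hy) (h.symm hc)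
        · rcases hc.2 with hc | hc <;> omega
    · refine iff_of_false (fun hc => ?_) fun hc => ?_
      · rw [hgm] at hc
        exact hdom _ (hmem x hx) _ (hmem z hz) hc
      · rcases hc.2 with hc | hc <;> omega
  · refine iff_of_true ?_ ⟨⟨hxy, hxz, hyz⟩, Or.inl (by omega)⟩
    have h1 := hinj x hx y hy hxy
    have h2 := hinj x hx z hz hxz
    rw [hgm] at h1 h2 ⊢
    exact hs _ (hmem y hy) _ (hmem z hz) h1 h2 (hinj y hy z hz hyz)

theorem IsExtremal.of_erase_source (h : IndepRel R) {w : ℕ} (hw : w ∈ V)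
    (hV : 4 ≤ #V) (hs : IsSource R V w) (hm : IsExtremal R (V.erase w)) : IsExtremal R V := by
  have hc := card_erase_add_one hw
  rcases hm with hm | ⟨h4, hm⟩ | ⟨h5, hm⟩
  · exact Or.inl (hm.of_erase_source h hw hV hs (by omega))
  · exact Or.inr (Or.inl ⟨hV, hm.of_erase_source h hw hV hs h4⟩)
  · exact Or.inr (Or.inr ⟨by omega, hm.of_erase_source h hw hV hs h5⟩)

theorem IsModel.exists_source {k : ℕ} {C : ℕ → ℕ → Prop} (hk : k < #V)
    (hm : IsModel (chainRel k C) R V) : ∃ w ∈ V, IsSource R V w := by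
  obtain ⟨g, hg, hR⟩ := hm
  obtain ⟨m, hVm⟩ : ∃ m, #V = m + 1 := ⟨#V - 1, by omega⟩
  rw [hVm] at hR hg hk
  have hgm : ∀ x < m + 1, g x ∈ V := fun x hx => hg.mapsTo (by simpa using hx)
  refine ⟨g m, hgm m (by omega), fun y hy z hz h1 h2 h3 => ?_⟩
  obtain ⟨y, hy', rfl⟩ := hg.surjOn hy
  obtain ⟨z, hz', rfl⟩ := hg.surjOn hz
  rw [mem_coe, mem_range] at hy' hz'
  have h1' : m ≠ y := fun e => h1 (e ▸ rfl)
  have h2' : m ≠ z := fun e => h2 (e ▸ rfl)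
  have h3' : y ≠ z := fun e => h3 (e ▸ rfl)
  exact (hR m (by omega) y hy' z hz').2 ⟨⟨h1', h2', h3'⟩, Or.inl (by omega)⟩

theorem IsExtremal.exists_source (hV : 6 ≤ #V) (hm : IsExtremal R V) :
    ∃ w ∈ V, IsSource R V w := by
  rcases hm with hm | ⟨-, hm⟩ | ⟨-, hm⟩
  all_goals exact hm.exists_source (by omega)

theorem isModel_triangleRel (h : IndepRel R) (hV : #V = 3) (hs : ∀ u ∈ V, IsSource R V u) :
    IsModel triangleRel R V := by
  obtain ⟨g, hg⟩ := exists_bijOn V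
  refine ⟨g, hg, fun x hx y hy z hz => ⟨fun hR => ?_, fun hR => ?_⟩⟩
  · refine ⟨⟨?_, ?_, ?_⟩, Or.inr ⟨by omega, by omega, by omega, trivial⟩⟩
    · rintro rfl; exact h.not_self_left hR
    · rintro rfl; exact h.not_self_right hR
    · rintro rfl; exact h.not_self hR
  · have hx' : x ∈ (range #V : Set ℕ) := by simpa using hx
    have hy' : y ∈ (range #V : Set ℕ) := by simpa using hy
    have hz' : z ∈ (range #V : Set ℕ) := by simpa using hz
    exact hs _ (hg.mapsTo hx') _ (hg.mapsTo hy') _ (hg.mapsTo hz')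
      (fun e => hR.1.1 (hg.injOn hx' hy' e)) (fun e => hR.1.2.1 (hg.injOn hx' hz' e))
      (fun e => hR.1.2.2 (hg.injOn hy' hz' e))

theorem isModel_apexRel (h : IndepRel R) {o : ℕ} (ho : o ∈ V)
    (hR : ∀ u ∈ V, ∀ y ∈ V, ∀ z ∈ V, u ≠ y → u ≠ z → y ≠ z → (R u y z ↔ u ≠ o ∧ (y = o ∨ z = o))) :
    IsModel (apexRel #V) R V := by
  obtain ⟨g, hg, rfl⟩ := exists_bijOn_zero ho
  refine ⟨g, hg, fun x hx y hy z hz => ?_⟩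
  by_cases hne : x ≠ y ∧ x ≠ z ∧ y ≠ z
  swap
  · refine iff_of_false (fun hc => hne ⟨?_, ?_, ?_⟩) fun hc => hne hc.1
    · rintro rfl; exact h.not_self_left hc
    · rintro rfl; exact h.not_self_right hc
    · rintro rfl; exact h.not_self hc
  have hmem : ∀ i < #V, i ∈ (range #V : Set ℕ) := fun i hi => by simpa using hi
  have hinj : ∀ i < #V, ∀ j < #V, (g i = g j ↔ i = j) := fun i hi j hj =>
    ⟨fun e => hg.injOn (hmem i hi) (hmem j hj) e, fun e => e ▸ rfl⟩
  have h0 : 0 < #V := by omega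
  rw [hR _ (hg.mapsTo (hmem x hx)) _ (hg.mapsTo (hmem y hy)) _ (hg.mapsTo (hmem z hz))
    (by rw [Ne, hinj x hx y hy]; exact hne.1) (by rw [Ne, hinj x hx z hz]; exact hne.2.1)
    (by rw [Ne, hinj y hy z hz]; exact hne.2.2), Ne, hinj x hx 0 h0, hinj y hy 0 h0, hinj z hz 0 h0]
  simp only [apexRel, chainRel]
  omega

/-- The count leaves no slack, so every local bound is tight. The sink `o` has no mutual neighbours,
every other element has `o` as its only out-neighbour, and the elements other than `o` are pairwise
mutual. Tightness then gives `R u o v` throughout, and a mutual neighbour admits no second partner.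
-/
theorem isModel_apexRel_of_sink (h : IndepRel R) (hV : #V = 4 ∨ #V = 5) {o : ℕ} (ho : o ∈ V)
    (hd : ∀ u ∈ V, ¬ IsDominant R V u) (hs : ∀ u ∈ V, outNbr R V u = ∅ ↔ u = o)
    (hc : 2 * ((#V).choose 3 + 2) ≤ count R V) : IsModel (apexRel #V) R V := by
  have hbound := fun u hu => outCount_add_four_le h (by omega : #V ≤ 6) hu (hd u hu)
  have hsum := sum_le_sum hbound
  have hfil : ({u ∈ V | outNbr R V u = ∅} : Finset ℕ) = {o} := by
    ext u
    simp only [mem_filter, mem_singleton]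
    exact ⟨fun hu => (hs u hu.1).1 hu.2, fun e => e ▸ ⟨ho, (hs o ho).2 rfl⟩⟩
  have hlhs : ∑ u ∈ V, (outCount R V u + 4) = count R V + 4 * #V := by
    rw [sum_add_distrib, sum_const, smul_eq_mul, count, mul_comm]
  have hrhs : ∑ u ∈ V, (2 * (2 * #(outNbr R V u) + #(mutualNbr R V u))
      + if outNbr R V u = ∅ then surplus #(mutualNbr R V u) else 0)
      = 2 * (#V * (#V - 1)) + surplus #(mutualNbr R V o) := by
    rw [sum_add_distrib, ← mul_sum, sum_card_nbr h, ← sum_filter, hfil, sum_singleton]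
  have hsurp : surplus #(mutualNbr R V o) ≤ 4 := surplus_antitone (Nat.zero_le _)
  -- Both sides are equal (28 for `#V = 4`, 44 for `#V = 5`), so the whole surplus 4 is needed.
  have hnum : 2 * (#V * (#V - 1)) + 4 ≤ 2 * ((#V).choose 3 + 2) + 4 * #V := by
    rcases hV with hV | hV <;> rw [hV] <;> decide
  have h4 : surplus #(mutualNbr R V o) = 4 := by omega
  have ho0 : mutualNbr R V o = ∅ := by
    rw [← card_eq_zero]
    by_contra hne
    have := surplus_antitone (Nat.one_le_iff_ne_zero.2 hne)
    rw [h4] at this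
    exact absurd this (by decide)
  have heq := (sum_eq_sum_iff_of_le hbound).1 (le_antisymm hsum (by omega))
  have hod : outNbr R V o = ∅ := (hs o ho).2 rfl
  have hno : ∀ y ∈ V, ∀ z ∈ V, ¬ R o y z := fun y hy z hz hR => by
    simpa [hod, ho0] using mem_nbr_of_rel h hy hz hR
  have hout : ∀ u ∈ V, u ≠ o → outNbr R V u = {o} := by
    intro u hu huo
    have h0 : outNbr R V u ≠ ∅ := fun e => huo ((hs u hu).1 e)
    have h1 := heq u hu
    rw [if_neg h0] at h1
    have hcard := outNbr_card_eq_one h (by omega) hu (hd u hu) h0 (by omega)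
    have hou : o ∈ outNbr R V u := by
      have := trichotomy h hu ho huo
      rwa [hod, mutualNbr_comm hu ho, ho0, or_iff_left (by simp)] at this
    obtain ⟨t, ht⟩ := card_eq_one.1 hcard
    rw [ht, mem_singleton] at hou
    rw [ht, hou]
  have hmut : ∀ u ∈ V, u ≠ o → ∀ v ∈ V, v ≠ o → u ≠ v → v ∈ mutualNbr R V u := by
    intro u hu huo v hv hvo huv
    have := trichotomy h hu hv huv
    simpa [hout u hu huo, hout v hv hvo, huo, hvo] using this
  have hmo : ∀ u ∈ V, u ≠ o → ∀ v ∈ V, v ≠ o → u ≠ v → R u o v := by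
    intro u hu huo v hv hvo huv
    have h1 := heq u hu
    rw [hout u hu huo, if_neg (by simp), card_singleton] at h1
    have hsub : {p ∈ V ×ˢ V | R u p.1 p.2} ⊆
        {p ∈ V ×ˢ V | R u p.1 p.2 ∧ p.1 ∈ mutualNbr R V u}
        ∪ {p ∈ ({o} : Finset ℕ) ×ˢ mutualNbr R V u | R u p.1 p.2} := by
      rintro ⟨y, z⟩ hp
      simp only [mem_filter, mem_product] at hp
      have g1 := mem_nbr_of_rel h hp.1.1 hp.1.2 hp.2
      have g2 := mem_nbr_of_rel h hp.1.2 hp.1.1 (h.symm hp.2)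
      have g3 := h.ne hp.2
      rw [hout u hu huo, mem_singleton] at g1 g2
      simp only [mem_union, mem_filter, mem_product, mem_singleton]
      rcases g1 with rfl | g1
      · rcases g2 with rfl | g2
        · exact absurd rfl g3
        · exact Or.inr ⟨⟨rfl, g2⟩, hp.2⟩
      · exact Or.inl ⟨hp.1, hp.2, g1⟩
    have h2 := (card_le_card hsub).trans (card_union_le _ _)
    have h3 := card_mutual_fst_le h V u
    rw [← outCount_eq_card] at h2
    -- Tightness makes `outCount R V u` twice the number of mutual neighbours. Pairs with mutual
    -- first member supply at most half, so all pairs `(o, v)` must occur.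
    have h4 : filter (fun p : ℕ × ℕ => R u p.1 p.2) (({o} : Finset ℕ) ×ˢ mutualNbr R V u)
        = ({o} : Finset ℕ) ×ˢ mutualNbr R V u :=
      eq_of_subset_of_card_le (filter_subset _ _) (by
        rw [card_product, card_singleton]
        omega)
    exact (filter_eq_self.1 h4) (o, v) (by simp [hmut u hu huo v hv hvo huv])
  refine isModel_apexRel h ho fun u hu y hy z hz huy huz hyz => ⟨fun hR => ?_, ?_⟩
  · have huo : u ≠ o := by
      rintro rfl
      exact hno y hy z hz hR
    refine ⟨huo, ?_⟩
    by_contra! hyo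
    exact hyo.2 (eq_of_mem_mutualNbr h (hmut u hu huo y hy hyo.1 huy) hR
      (h.symm (hmo u hu huo y hy hyo.1 huy)))
  · rintro ⟨huo, rfl | rfl⟩
    · exact hmo u hu huo z hz hyz.symm huz
    · exact h.symm (hmo u hu huo y hy hyz huy)

/-! ### Induction for the extremal bound -/

/-- The extremal statement for a set of `n` elements. -/
def ExtremalBound (n : ℕ) : Prop :=
  ∀ (R : ℕ → ℕ → ℕ → Prop) (V : Finset ℕ), IndepRel R → #V = n →
    2 * (n.choose 3 + 2) ≤ count R V → count R V = 2 * (n.choose 3 + 2) ∧ IsExtremal R V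

theorem extremalBound_three : ExtremalBound 3 := by
  intro R V h hV hc
  have h1 : ∀ u ∈ V, outCount R V u ≤ 2 := fun u hu => by
    simpa [hV] using outCount_le h hu
  have h2 : ∑ u ∈ V, 2 = 6 := by simp [hV]
  have h3 : 6 ≤ count R V := hc
  have h4 := sum_le_sum h1
  rw [h2] at h4
  have heq := (sum_eq_sum_iff_of_le h1).1 (le_antisymm (sum_le_sum h1) (by rw [h2]; exact h3))
  refine ⟨le_antisymm h4 h3, Or.inl (isModel_triangleRel h hV fun u hu => ?_)⟩
  exact isSource_of_outCount h hu (by rw [hV, heq u hu])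

theorem choose_three_succ (n : ℕ) : 2 * (n + 1).choose 3 = 2 * n.choose 3 + n * (n - 1) := by
  have h1 : (n + 1).choose 3 = n.choose 2 + n.choose 3 := Nat.choose_succ_succ n 2
  have h2 := Nat.choose_two_right n
  have h3 : 2 ∣ n * (n - 1) := (Nat.even_mul_pred_self n).two_dvd
  omega

/-- Deleting `u` loses only `outCount`, at most `n(n-1)`, which is the growth of the doubled bound.
So the remainder attains its bound and `u` attains its maximal out-count. -/
theorem exists_source_of_dominant (h : IndepRel R) {n : ℕ} (ih : ExtremalBound n)
    (hV : #V = n + 1) {u : ℕ} (hu : u ∈ V) (hd : IsDominant R V u)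
    (hc : 2 * ((n + 1).choose 3 + 2) ≤ count R V) :
    IsSource R V u ∧ count R V = 2 * ((n + 1).choose 3 + 2) ∧ IsExtremal R (V.erase u) := by
  have h1 := count_eq_erase h hu
  rw [inCount_eq_zero hd] at h1
  have h2 := outCount_le h hu
  have h3 := choose_three_succ n
  rw [hV, Nat.add_sub_cancel] at h2
  have h4 : n + 1 - 2 = n - 1 := by omega
  rw [h4] at h2
  have hcard : #(V.erase u) = n := by rw [card_erase_of_mem hu, hV, Nat.add_sub_cancel]
  obtain ⟨h5, h6⟩ := ih R (V.erase u) h hcard (by omega)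
  refine ⟨isSource_of_outCount h hu ?_, by omega, h6⟩
  rw [hV, Nat.add_sub_cancel, h4]
  omega

theorem ExtremalBound.of_source {n : ℕ} (hn : 3 ≤ n) (ih : ExtremalBound n) (h : IndepRel R)
    (hV : #V = n + 1) {u : ℕ} (hu : u ∈ V) (hd : IsDominant R V u)
    (hc : 2 * ((n + 1).choose 3 + 2) ≤ count R V) :
    count R V = 2 * ((n + 1).choose 3 + 2) ∧ IsExtremal R V := by
  obtain ⟨h1, h2, h3⟩ := exists_source_of_dominant h ih hV hu hd hc
  exact ⟨h2, h3.of_erase_source h hu (by omega) h1⟩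

theorem extremalBound_small {n : ℕ} (hn : 3 ≤ n) (hn' : n ≤ 5) (ih : ExtremalBound n) :
    ExtremalBound (n + 1) := by
  intro R V h hV hc
  by_cases hdom : ∃ u ∈ V, IsDominant R V u
  · obtain ⟨u, hu, hd⟩ := hdom
    exact ih.of_source hn h hV hu hd hc
  push Not at hdom
  have hsum := sum_outCount_le h (by omega) hdom
  -- On 6 elements the count is at most 60 - 24 + 6 = 42, below the required 44.
  rcases hn'.eq_or_lt with rfl | hn5
  · exfalso
    have := sum_surplus_le h (by omega : #V ≤ 6)
    have h20 : (5 + 1).choose 3 = 20 := by decide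
    rw [hV] at hsum
    omega
  have hV' : #V = 4 ∨ #V = 5 := by omega
  have hnum : 2 * (#V * (#V - 1)) + 4 = 2 * ((#V).choose 3 + 2) + 4 * #V := by
    rcases hV' with hV | hV <;> rw [hV] <;> decide
  rw [← hV] at hc ⊢
  have hex : ∃ o ∈ V, outNbr R V o = ∅ := by
    by_contra! hne
    rw [sum_eq_zero] at hsum
    · omega
    · intro u hu
      exact absurd (mem_filter.1 hu).2 (hne u (mem_filter.1 hu).1).ne_empty
  obtain ⟨o, ho, ho0⟩ := hex
  by_cases huniq : ∀ u ∈ V, outNbr R V u = ∅ → u = o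
  · have hs : ∀ u ∈ V, outNbr R V u = ∅ ↔ u = o := fun u hu => ⟨huniq u hu, fun e => e ▸ ho0⟩
    have hm := isModel_apexRel_of_sink h hV' ho hdom hs hc
    have hfil : ({u ∈ V | outNbr R V u = ∅} : Finset ℕ) = {o} := by
      ext u
      simp only [mem_filter, mem_singleton]
      exact ⟨fun hu => (hs u hu.1).1 hu.2, fun e => e ▸ ⟨ho, (hs o ho).2 rfl⟩⟩
    have hsurp : surplus #(mutualNbr R V o) ≤ 4 := surplus_antitone (Nat.zero_le _)
    rw [hfil, sum_singleton] at hsum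
    refine ⟨by omega, Or.inr ?_⟩
    rcases hV' with hV' | hV'
    · exact Or.inl ⟨hV'.ge, by rwa [hV'] at hm⟩
    · exact Or.inr ⟨hV'.ge, by rwa [hV'] at hm⟩
  · exfalso
    push Not at huniq
    obtain ⟨u, hu, hu0, huo⟩ := huniq
    obtain ⟨z, hz, r1, r2, r3⟩ := exists_full_triple h hu ho huo hu0 ho0
    have hsub : ({u, o, z} : Finset ℕ) ⊆ V := by simp [insert_subset_iff, hu, ho, hz]
    rcases hV' with hV' | hV'
    · obtain ⟨x, hx, hxd⟩ := exists_dominant_of_full_triple h r1 r2 r3 hsub hV'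
      exact hdom x hx hxd
    · have := count_le_of_full_triple h r1 r2 r3 hsub hV' hdom
      rw [hV', (by decide : Nat.choose 5 3 = 10)] at hc
      omega

/-- Degrees are even, so otherwise each exceeds `(#V-1)(#V-2)` by at least 2. The total excess is
12, giving `2 * #V ≤ 12`. -/
theorem exists_degree_le (h : IndepRel R) (hV : 7 ≤ #V)
    (hc : count R V = 2 * ((#V).choose 3 + 2)) :
    ∃ w ∈ V, outCount R V w + 2 * inCount R V w ≤ (#V - 1) * (#V - 2) := by
  by_contra! hlt
  obtain ⟨m, hm⟩ : ∃ m, #V = m + 2 := ⟨#V - 2, by omega⟩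
  have h1 : ∀ w ∈ V, (#V - 1) * (#V - 2) + 2 ≤ outCount R V w + 2 * inCount R V w := by
    intro w hw
    have h2 := hlt w hw
    have h3 : Even ((#V - 1) * (#V - 2)) := Nat.even_mul_pred_self (#V - 1)
    have h4 : Even (outCount R V w + 2 * inCount R V w) :=
      (even_outCount h V w).add (even_two_mul _)
    obtain ⟨a, ha⟩ := h3
    obtain ⟨b, hb⟩ := h4
    omega
  have h2 := card_nsmul_le_sum V _ _ h1
  rw [sum_degree, hc, smul_eq_mul] at h2
  have h3 : 6 * (#V).choose 3 = #V * ((#V - 1) * (#V - 2)) := by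
    have := Nat.descFactorial_eq_factorial_mul_choose #V 3
    simp only [Nat.descFactorial_succ, Nat.descFactorial_zero, Nat.factorial] at this
    rw [hm] at this ⊢
    simp only [Nat.add_sub_cancel, (by omega : m + 2 - 1 = m + 1), Nat.sub_zero] at this ⊢
    linarith
  rw [mul_add] at h2
  omega

/-- If no triple at `w` contains `w'`, then `w'` remains dominant. Otherwise the degree of `w'`
forces `R w w' z` for every other `z`, and `w` is dominant. -/
theorem exists_dominant_of_source_erase (h : IndepRel R) {w w' : ℕ} (hw : w ∈ V) (hw' : w' ∈ V)
    (hne : w ≠ w') (hV : 6 ≤ #V) (hs : IsSource R (V.erase w) w')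
    (hdeg : (#V - 1) * (#V - 2) ≤ outCount R V w' + 2 * inCount R V w') :
    ∃ u ∈ V, IsDominant R V u := by
  obtain ⟨W, hwW, rfl⟩ : ∃ W, w ∉ W ∧ V = insert w W :=
    ⟨V.erase w, notMem_erase w V, (insert_erase hw).symm⟩
  rw [card_insert_of_notMem hwW] at *
  rw [erase_insert hwW] at hs
  have hw'W : w' ∈ W := mem_of_mem_insert_of_ne hw' hne.symm
  have hdom := hs.isDominant h (by omega : 4 ≤ #W)
  have hthird : ∀ v ∈ W, ¬ R v w' w := by
    intro v hv hR
    obtain ⟨t, ht, ht'⟩ := exists_mem_notMem_of_card_lt_card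
      (s := {v, w'}) (t := W) (lt_of_le_of_lt card_le_two (by omega))
    simp only [mem_insert, mem_singleton, not_or] at ht'
    have hR' := hs v hv t ht (h.ne_left hR).symm (Ne.symm ht'.2) (Ne.symm ht'.1)
    exact hwW (h.unique hR hR' ▸ ht)
  by_cases hq : ∃ v ∈ W, R w w' v
  swap
  · push Not at hq
    refine ⟨w', hw', fun x hx z hz hR => ?_⟩
    rcases mem_insert.1 hx with rfl | hxW
    · rcases mem_insert.1 hz with rfl | hzW
      · exact h.ne_right hR rfl
      · exact hq z hzW hR
    · rcases mem_insert.1 hz with rfl | hzW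
      · exact hthird x hxW hR
      · exact hdom x hxW z hzW hR
  obtain ⟨v₀, hv₀, hRv⟩ := hq
  have hin : inCount R (insert w W) w' = ∑ v ∈ W, if R w w' v then 1 else 0 := by
    have h0 := inCount_eq_zero hdom
    have h1 : ∑ x ∈ W, (if R x w' w then 1 else 0) = 0 :=
      sum_eq_zero fun x hx => if_neg (hthird x hx)
    simp only [inCount] at h0
    have h2 : ¬ R w w' w := h.not_self_right
    simp only [inCount, sum_insert hwW, sum_add_distrib, h0, h1, h2, if_false, zero_add, add_zero]
  rw [outCount_insert h hwW, hin] at hdeg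
  have hout := outCount_le h hw'W
  have hpf : ∀ u v, (∑ z ∈ W, if R u v z then 1 else 0) = #{z ∈ W | R u v z} := fun u v => by
    rw [sum_boole, Nat.cast_id]
  rw [hpf, hpf] at hdeg
  obtain ⟨m, hm⟩ : ∃ m, #W = m + 2 := ⟨#W - 2, by omega⟩
  have hmul : (#W + 1 - 1) * (#W + 1 - 2) = (#W - 1) * (#W - 2) + 2 * (#W - 1) := by
    rw [hm]
    simp only [Nat.add_sub_cancel, (by omega : m + 2 + 1 - 2 = m + 1), (by omega : m + 2 - 1 = m + 1)]
    ring
  -- If both sets were non-empty, `unique` would give each at most one element, contradicting `#W -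
  -- 1 ≥ 4`. The second is non-empty, so the first is empty.
  have hle : #W - 1 ≤ #{z ∈ W | R w' w z} + #{z ∈ W | R w w' z} := by omega
  have hp : ∀ z ∈ W, ¬ R w' w z := by
    intro z hz hR
    have c1 : #{z ∈ W | R w' w z} ≤ 1 := card_le_one.2 fun a ha b hb =>
      (h.unique (mem_filter.1 ha).2 hRv).trans (h.unique (mem_filter.1 hb).2 hRv).symm
    have c2 : #{z ∈ W | R w w' z} ≤ 1 := card_le_one.2 fun a ha b hb =>
      (h.unique (mem_filter.1 ha).2 hR).trans (h.unique (mem_filter.1 hb).2 hR).symm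
    omega
  rw [filter_eq_empty_iff.2 (fun z hz => hp z hz), card_empty, zero_add] at hle
  have hfull : ∀ z ∈ W, z ≠ w' → R w w' z := by
    have hsub : {z ∈ W | R w w' z} ⊆ W.erase w' := fun z hz =>
      mem_erase.2 ⟨(h.ne (mem_filter.1 hz).2).symm, (mem_filter.1 hz).1⟩
    have := eq_of_subset_of_card_le hsub (by rwa [card_erase_of_mem hw'W])
    intro z hz hzw
    have hz' : z ∈ W.erase w' := mem_erase.2 ⟨hzw, hz⟩
    rw [← this] at hz'
    exact (mem_filter.1 hz').2
  refine ⟨w, hw, fun x hx z hz hR => ?_⟩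
  have hzW : z ∈ W := mem_of_mem_insert_of_ne hz (h.ne hR).symm
  have hxW : x ∈ W := mem_of_mem_insert_of_ne hx (h.ne_left hR)
  by_cases hxw : x = w'
  · rw [hxw] at hR
    exact hp z hzW hR
  · have hR' := h.unique hR (h.symm (hfull x hxW hxw))
    rw [hR'] at hR
    exact hthird x hxW (h.symm hR)

theorem extremalBound_succ {n : ℕ} (hn : 6 ≤ n) (ih : ExtremalBound n) :
    ExtremalBound (n + 1) := by
  intro R V h hV hc
  obtain ⟨R', h', hsub, hc'⟩ := exists_subrelation h V _ hc
  have hch := choose_three_succ n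
  have hdom : ∃ u ∈ V, IsDominant R' V u := by
    obtain ⟨w, hw, hdeg⟩ := exists_degree_le (V := V) h' (by omega) (by rw [hc', hV])
    have e1 := count_eq_erase h' hw
    have e2 : (#V - 1) * (#V - 2) = n * (n - 1) := by
      rw [hV, Nat.add_sub_cancel, (by omega : n + 1 - 2 = n - 1)]
    have hcard : ∀ u ∈ V, #(V.erase u) = n := fun u hu => by
      rw [card_erase_of_mem hu, hV, Nat.add_sub_cancel]
    have e3 := ih R' (V.erase w) h' (hcard w hw) (by omega)
    obtain ⟨w', hw', hs⟩ := e3.2.exists_source (by rw [hcard w hw]; exact hn)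
    obtain ⟨hne, hw'V⟩ := mem_erase.1 hw'
    refine exists_dominant_of_source_erase h' hw hw'V hne.symm (by omega) hs ?_
    have e4 := count_eq_erase h' hw'V
    -- A smaller degree of `w'` would leave, after deleting `w'`, more than the bound for `n`
    -- elements allows.
    by_contra! hlt
    have e5 := ih R' (V.erase w') h' (hcard w' hw'V) (by omega)
    omega
  obtain ⟨u, hu, hd⟩ := hdom
  have hs := (exists_source_of_dominant h' ih hV hu hd hc'.ge).1
  have hs' : IsSource R V u := fun y hy z hz h1 h2 h3 => hsub _ _ _ (hs y hy z hz h1 h2 h3)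
  exact ih.of_source (by omega) h hV hu (hs'.isDominant h (by omega)) hc

theorem extremalBound {n : ℕ} (hn : 3 ≤ n) : ExtremalBound n := by
  induction n, hn using Nat.le_induction with
  | base => exact extremalBound_three
  | succ n hn ih =>
    rcases le_or_gt n 5 with h | h
    · exact extremalBound_small hn h ih
    · exact extremalBound_succ h ih

end IndepRel

/-! ### Flags as pointed triples -/

namespace FlagGraph

open Finset
open scoped Classical

theorem setsInGeneralPosition_comm {α : Type*} [DecidableEq α] {S X Y : Finset α} :
    SetsInGeneralPosition S X Y ↔ SetsInGeneralPosition S Y X := by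
  rw [SetsInGeneralPosition, SetsInGeneralPosition, union_comm, inter_comm]

theorem setsInGeneralPosition_singleton {S : Finset ℕ} (hS : 3 ≤ #S) {a b : ℕ} :
    SetsInGeneralPosition S {a} {b} ↔ a ≠ b := by
  constructor
  · rintro (h | h)
    · have := card_union_le ({a} : Finset ℕ) {b}
      rw [h, card_singleton, card_singleton] at this
      omega
    · rw [← disjoint_iff_inter_eq_empty, disjoint_singleton] at h
      exact h
  · intro h
    refine Or.inr ?_
    rwa [← disjoint_iff_inter_eq_empty, disjoint_singleton]

theorem setsInGeneralPosition_singleton_sdiff {S P : Finset ℕ} {a : ℕ} (ha : a ∈ S)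
    (hPS : P ⊆ S) (hP : 2 ≤ #P) : SetsInGeneralPosition S {a} (S \ P) ↔ a ∈ P := by
  have hc := card_sdiff_add_card_eq_card hPS
  constructor
  · rintro (h | h)
    · have := card_union_le {a} (S \ P)
      rw [h, card_singleton] at this
      omega
    · rw [← disjoint_iff_inter_eq_empty, disjoint_singleton_left, mem_sdiff] at h
      tauto
  · intro h
    refine Or.inr ?_
    rw [← disjoint_iff_inter_eq_empty, disjoint_singleton_left, mem_sdiff]
    tauto

/-- Disjoint complements would mean `P ∪ Q = S`, which the sizes exclude. For two pairs in `[n]`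
this uses `n ≥ 5`. -/
theorem setsInGeneralPosition_sdiff {S P Q : Finset ℕ} (hPS : P ⊆ S)
    (hPQ : #P + #Q < #S) : SetsInGeneralPosition S (S \ P) (S \ Q) ↔ Disjoint P Q := by
  constructor
  · rintro (h | h)
    · rw [disjoint_left]
      intro t ht ht'
      have : t ∈ S \ P ∪ S \ Q := by
        rw [h]
        exact hPS ht
      simp only [mem_union, mem_sdiff] at this
      tauto
    · exfalso
      rw [← sdiff_union_distrib, sdiff_eq_empty_iff_subset] at h
      have := (card_le_card h).trans (card_union_le P Q)
      omega
  · intro h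
    refine Or.inl ?_
    ext t
    have := @h.notMem_of_mem_left_finset _ _ _ t
    simp only [mem_union, mem_sdiff]
    tauto

/-- The numbers `x, y, z` are less than `n` and pairwise distinct. -/
def Distinct (n x y z : ℕ) : Prop := (x < n ∧ y < n ∧ z < n) ∧ x ≠ y ∧ x ≠ z ∧ y ≠ z

/-- The complement of `{n - y, n - z}` in `[n]`. -/
def coPair (n y z : ℕ) : Finset ℕ := Icc 1 n \ {n - y, n - z}

/-- The flag `f` consists of `{n - x}` and of the complement of `{n - y, n - z}`. -/
def IsCoord {n : ℕ} (f : GammaVertex n {1, n - 2}) (x y z : ℕ) : Prop :=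
  Distinct n x y z ∧ f.1 = {{n - x}, coPair n y z}

variable {n x y z x' y' z' : ℕ} {f f' : GammaVertex n {1, n - 2}}

instance (n : ℕ) (T : Finset ℕ) : Finite (GammaVertex n T) :=
  Finite.of_injective
    (fun f => (⟨f.1, mem_powerset.2 fun X hX => mem_powerset.2 (f.2.1.1 X hX).2.1⟩ :
      {s // s ∈ (Icc 1 n).powerset.powerset}))
    fun _ _ h => Subtype.ext (Subtype.mk.inj h)

theorem pair_subset (hd : Distinct n x y z) : ({n - y, n - z} : Finset ℕ) ⊆ Icc 1 n := by
  obtain ⟨⟨hx, hy, hz⟩, -⟩ := hd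
  intro t
  simp only [mem_insert, mem_singleton, mem_Icc]
  omega

theorem card_pair_eq (hd : Distinct n x y z) : #({n - y, n - z} : Finset ℕ) = 2 := by
  obtain ⟨⟨hx, hy, hz⟩, h1, h2, h3⟩ := hd
  exact card_pair (by omega)

theorem card_coPair (hd : Distinct n x y z) : #(coPair n y z) = n - 2 := by
  rw [coPair, card_sdiff_of_subset (pair_subset hd), card_pair_eq hd, Nat.card_Icc]
  omega

theorem exists_isCoord_of_distinct (hn : 5 ≤ n) (hd : Distinct n x y z) :
    ∃ f : GammaVertex n {1, n - 2}, IsCoord f x y z := by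
  have hB := card_coPair hd
  have hsub : ({n - x} : Finset ℕ) ⊆ coPair n y z := by
    obtain ⟨⟨hx, hy, hz⟩, h1, h2, h3⟩ := hd
    rw [singleton_subset_iff, coPair, mem_sdiff, mem_Icc, mem_insert, mem_singleton]
    omega
  have hBss : coPair n y z ⊂ Icc 1 n := by
    refine ssubset_of_subset_of_ne sdiff_subset fun he => ?_
    rw [he, Nat.card_Icc] at hB
    omega
  refine ⟨⟨{{n - x}, coPair n y z}, ⟨?_, ?_⟩, ?_⟩, hd, rfl⟩
  · intro X hX
    rw [mem_insert, mem_singleton] at hX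
    rcases hX with rfl | rfl
    · exact ⟨singleton_nonempty _, hsub.trans_ssubset hBss⟩
    · exact ⟨(singleton_nonempty _).mono hsub, hBss⟩
  · intro X hX Y hY
    rw [mem_insert, mem_singleton] at hX hY
    rcases hX with rfl | rfl <;> rcases hY with rfl | rfl
    · exact Or.inl subset_rfl
    · exact Or.inl hsub
    · exact Or.inr hsub
    · exact Or.inl subset_rfl
  · rw [flagType, image_insert, image_singleton, card_singleton, hB]

theorem exists_isCoord (hn : 5 ≤ n) (f : GammaVertex n {1, n - 2}) :
    ∃ x y z, IsCoord f x y z := by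
  obtain ⟨f, ⟨hf1, hf2⟩, hf3⟩ := f
  have h1 : (1 : ℕ) ∈ flagType f := by simp [hf3]
  have h2 : n - 2 ∈ flagType f := by simp [hf3]
  obtain ⟨X, hX, hX1⟩ := mem_image.1 h1
  obtain ⟨Y, hY, hY1⟩ := mem_image.1 h2
  have heq : ∀ Z ∈ f, ∀ W ∈ f, #Z = #W → Z = W := by
    intro Z hZ W hW hc
    rcases hf2 Z hZ W hW with h | h
    · exact eq_of_subset_of_card_le h hc.ge
    · exact (eq_of_subset_of_card_le h hc.le).symm
  have hXY : X ⊆ Y := by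
    rcases hf2 X hX Y hY with h | h
    · exact h
    · have := card_le_card h
      omega
  have hf : f = {X, Y} := by
    ext Z
    rw [mem_insert, mem_singleton]
    constructor
    · intro hZ
      have : #Z ∈ flagType f := mem_image_of_mem _ hZ
      rw [hf3, mem_insert, mem_singleton] at this
      rcases this with h | h
      · exact Or.inl (heq Z hZ X hX (h.trans hX1.symm))
      · exact Or.inr (heq Z hZ Y hY (h.trans hY1.symm))
    · rintro (rfl | rfl) <;> assumption
  have hYs := (hf1 Y hY).2.1
  obtain ⟨a, rfl⟩ := card_eq_one.1 hX1
  obtain ⟨b, c, hbc, hb⟩ := card_eq_two.1 (by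
    rw [card_sdiff_of_subset hYs, hY1, Nat.card_Icc]
    omega : #(Icc 1 n \ Y) = 2)
  have hYeq : Y = Icc 1 n \ {b, c} := by
    rw [← hb, Finset.sdiff_sdiff_eq_self hYs]
  have ha : a ∈ Y := singleton_subset_iff.1 hXY
  have ha' := hYs ha
  have hbm : b ∈ Icc 1 n \ Y := by simp [hb]
  have hcm : c ∈ Icc 1 n \ Y := by simp [hb]
  rw [mem_sdiff, mem_Icc] at hbm hcm
  rw [mem_Icc] at ha'
  have hab : a ≠ b := fun e => hbm.2 (e ▸ ha)
  have hac : a ≠ c := fun e => hcm.2 (e ▸ ha)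
  refine ⟨n - a, n - b, n - c, ⟨⟨by omega, by omega, by omega⟩, by omega, by omega, by omega⟩, ?_⟩
  change f = _
  rw [hf, coPair, hYeq]
  congr 2 <;> [omega; (congr 2 <;> [omega; (congr 1; omega)])]

theorem IsCoord.eq_of_pair_eq (hn : 5 ≤ n) (hf : IsCoord f x y z) {A B : Finset ℕ}
    (h : f.1 = {A, B}) (hA : #A = 1) (hB : #B = n - 2) : A = {n - x} ∧ B = coPair n y z := by
  obtain ⟨hd, hf⟩ := hf
  have hc := card_coPair hd
  rw [hf] at h
  have h1 : A ∈ ({{n - x}, coPair n y z} : Finset (Finset ℕ)) := by simp [h]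
  have h2 : B ∈ ({{n - x}, coPair n y z} : Finset (Finset ℕ)) := by simp [h]
  rw [mem_insert, mem_singleton] at h1 h2
  constructor
  · rcases h1 with rfl | rfl
    · rfl
    · omega
  · rcases h2 with rfl | rfl
    · rw [card_singleton] at hB
      omega
    · rfl

theorem IsCoord.symm (h : IsCoord f x y z) : IsCoord f x z y := by
  obtain ⟨⟨⟨hx, hy, hz⟩, h1, h2, h3⟩, h⟩ := h
  exact ⟨⟨⟨hx, hz, hy⟩, h2, h1, h3.symm⟩, by rw [h, coPair, coPair, pair_comm (n - y)]⟩

theorem IsCoord.unique (h : IsCoord f x y z) (h' : IsCoord f' x y z) : f = f' :=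
  Subtype.ext (h.2.trans h'.2.symm)

theorem IsCoord.coord_iff (hn : 5 ≤ n) (h : IsCoord f x y z) :
    IsCoord f x' y' z' ↔ x' = x ∧ (y' = y ∧ z' = z ∨ y' = z ∧ z' = y) := by
  constructor
  · intro h'
    obtain ⟨h1, h2⟩ := h.eq_of_pair_eq hn h'.2 (card_singleton _) (card_coPair h'.1)
    have h3 := pair_subset h.1
    have h3' := pair_subset h'.1
    have h4 : ({n - y', n - z'} : Finset ℕ) = {n - y, n - z} := by
      rw [← Finset.sdiff_sdiff_eq_self h3, ← Finset.sdiff_sdiff_eq_self h3']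
      exact congrArg (Icc 1 n \ ·) h2
    obtain ⟨⟨⟨hx, hy, hz⟩, e1, e2, e3⟩, -⟩ := h
    obtain ⟨⟨⟨hx', hy', hz'⟩, e1', e2', e3'⟩, -⟩ := h'
    rw [singleton_inj] at h1
    have h5 : n - y' ∈ ({n - y, n - z} : Finset ℕ) := by simp [← h4]
    have h6 : n - z' ∈ ({n - y, n - z} : Finset ℕ) := by simp [← h4]
    rw [mem_insert, mem_singleton] at h5 h6
    omega
  · rintro ⟨rfl, ⟨rfl, rfl⟩ | ⟨rfl, rfl⟩⟩
    · exact h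
    · exact h.symm

theorem IsCoord.adj_iff (hn : 5 ≤ n) (h : IsCoord f x y z) (h' : IsCoord f' x' y' z') :
    (Gamma n {1, n - 2}).Adj f f' ↔
      (x = y' ∨ x = z') ∧ (x' = y ∨ x' = z) ∧ (y ≠ y' ∧ y ≠ z') ∧ z ≠ y' ∧ z ≠ z' := by
  have key : FlagsInGeneralPosition (Icc 1 n) f.1 f'.1 ↔
      (x = y' ∨ x = z') ∧ (x' = y ∨ x' = z) ∧ (y ≠ y' ∧ y ≠ z') ∧ z ≠ y' ∧ z ≠ z' := by
    have c1 := card_pair_eq h.1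
    have c2 := card_pair_eq h'.1
    have cn : #(Icc 1 n) = n := by simp
    have ha := pair_subset h.1
    have ha' := pair_subset h'.1
    have hx : n - x ∈ Icc 1 n := mem_Icc.2 (by have := h.1.1; omega)
    have hx' : n - x' ∈ Icc 1 n := mem_Icc.2 (by have := h'.1.1; omega)
    simp only [FlagsInGeneralPosition, h.2, h'.2, mem_insert, mem_singleton, forall_eq_or_imp,
      forall_eq]
    rw [setsInGeneralPosition_singleton (by omega), coPair, coPair,
      setsInGeneralPosition_singleton_sdiff hx ha' c2.ge,
      setsInGeneralPosition_comm, setsInGeneralPosition_singleton_sdiff hx' ha c1.ge,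
      setsInGeneralPosition_sdiff ha (by omega)]
    obtain ⟨⟨⟨hx, hy, hz⟩, e1, e2, e3⟩, -⟩ := h
    obtain ⟨⟨⟨hx', hy', hz'⟩, e1', e2', e3'⟩, -⟩ := h'
    simp only [disjoint_insert_left, disjoint_singleton_left, mem_insert, mem_singleton]
    omega
  change f ≠ f' ∧ _ ↔ _
  rw [key, and_iff_right_iff_imp]
  rintro h1 rfl
  have h2 := (h.coord_iff hn).1 h'
  have h3 := h.1.2
  omega

theorem mem_familyF_iff (hn : 5 ≤ n) (h : IsCoord f x y z) (i : ℕ) :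
    f ∈ familyF i n 1 (n - 2) ↔
      ((Icc 1 i ⊆ coPair n y z ∧ coPair n y z ⊆ Icc 1 (n - 1)) ∨
        MinCondition i {n - x} (coPair n y z)) := by
  constructor
  · rintro ⟨A, B, h1, h2, h3, h4⟩
    obtain ⟨rfl, rfl⟩ := h.eq_of_pair_eq hn h1 h2 h3
    exact h4
  · exact fun h' => ⟨_, _, h.2, card_singleton _, card_coPair h.1, h'⟩

theorem mem_familyFBar_iff (hn : 5 ≤ n) (h : IsCoord f x y z) (i : ℕ) :
    f ∈ familyFBar i n 1 (n - 2) ↔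
      (Icc 1 i ⊆ coPair n y z ∨ MinCondition i {n - x} (coPair n y z)) := by
  constructor
  · rintro ⟨A, B, h1, h2, h3, h4⟩
    obtain ⟨rfl, rfl⟩ := h.eq_of_pair_eq hn h1 h2 h3
    exact h4
  · exact fun h' => ⟨_, _, h.2, card_singleton _, card_coPair h.1, h'⟩

theorem minCondition_singleton {i a : ℕ} {B : Finset ℕ} :
    MinCondition i {a} B ↔ a ≤ i ∧ Icc 1 a ⊆ B := by
  rw [MinCondition, coe_singleton]
  constructor
  · rintro ⟨m, h1, h2⟩
    obtain rfl : m = a := h1.1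
    exact h2
  · exact fun h => ⟨a, isLeast_singleton, h⟩

theorem Icc_subset_coPair {i : ℕ} (hi : i ≤ n) (hd : Distinct n x y z) :
    Icc 1 i ⊆ coPair n y z ↔ i < n - y ∧ i < n - z := by
  obtain ⟨⟨hx, hy, hz⟩, -⟩ := hd
  constructor
  · intro h
    constructor <;> by_contra hc
    · have := h (mem_Icc.2 ⟨by omega, not_lt.1 hc⟩)
      simp [coPair] at this
    · have := h (mem_Icc.2 ⟨by omega, not_lt.1 hc⟩)
      simp [coPair] at this
  · intro h t ht
    rw [mem_Icc] at ht
    rw [coPair, mem_sdiff, mem_Icc, mem_insert, mem_singleton]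
    omega

theorem coPair_subset_Icc (hd : Distinct n x y z) :
    coPair n y z ⊆ Icc 1 (n - 1) ↔ y = 0 ∨ z = 0 := by
  obtain ⟨⟨hx, hy, hz⟩, -⟩ := hd
  constructor
  · intro h
    by_contra! hc
    have : n ∈ coPair n y z := by
      rw [coPair, mem_sdiff, mem_Icc, mem_insert, mem_singleton]
      omega
    have := mem_Icc.1 (h this)
    omega
  · intro h t ht
    rw [coPair, mem_sdiff, mem_Icc, mem_insert, mem_singleton] at ht
    rw [mem_Icc]
    omega

/-- The set `F` consists of the vertices whose coordinates satisfy the relation `S`. -/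
def HasRel (S : ℕ → ℕ → ℕ → Prop) (F : Set (GammaVertex n {1, n - 2})) : Prop :=
  ∀ f x y z, IsCoord f x y z → (f ∈ F ↔ S x y z)

/-- Under `x ↦ n - x`, condition (II) says that `x ≥ k` and `x` is the largest label. Condition (I)
says that `y, z < k` and, since `n` corresponds to label 0, that one of them is 0. -/
theorem hasRel_familyF_apex {k : ℕ} (hn : 5 ≤ n) (hk : k ≤ n) :
    HasRel (IndepRel.apexRel k) (familyF (n - k) n 1 (n - 2)) := by
  intro f x y z h
  rw [mem_familyF_iff hn h, minCondition_singleton, coPair_subset_Icc h.1,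
    Icc_subset_coPair (by omega) h.1, Icc_subset_coPair (by omega) h.1]
  obtain ⟨⟨⟨hx, hy, hz⟩, e1, e2, e3⟩, -⟩ := h
  simp only [IndepRel.apexRel, IndepRel.chainRel]
  omega

theorem hasRel_familyFBar (hn : 5 ≤ n) :
    HasRel IndepRel.triangleRel (familyFBar (n - 3) n 1 (n - 2)) := by
  intro f x y z h
  rw [mem_familyFBar_iff hn h, minCondition_singleton,
    Icc_subset_coPair (by omega) h.1, Icc_subset_coPair (by omega) h.1]
  obtain ⟨⟨⟨hx, hy, hz⟩, e1, e2, e3⟩, -⟩ := h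
  simp only [IndepRel.triangleRel, IndepRel.chainRel, and_true]
  omega

/-- The relation describing a set of vertices by coordinates. -/
def coordRel (F : Set (GammaVertex n {1, n - 2})) (x y z : ℕ) : Prop :=
  ∃ f ∈ F, IsCoord f x y z

theorem hasRel_coordRel (F : Set (GammaVertex n {1, n - 2})) : HasRel (coordRel F) F := by
  intro f x y z h
  refine ⟨fun hf => ⟨f, hf, h⟩, ?_⟩
  rintro ⟨f', hf', h'⟩
  rwa [h.unique h']

theorem indepRel_coordRel (hn : 5 ≤ n) {F : Set (GammaVertex n {1, n - 2})}
    (hF : (Gamma n {1, n - 2}).IsIndepSet F) : IndepRel (coordRel F) := by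
  refine ⟨fun ⟨f, hf, h⟩ => ⟨f, hf, h.symm⟩, fun ⟨f, hf, h⟩ => h.1.2.1,
    fun ⟨f, hf, h⟩ => h.1.2.2.2, ?_⟩
  rintro x y z w ⟨f, hf, h⟩ ⟨f', hf', h'⟩
  by_contra hzw
  have hadj : (Gamma n {1, n - 2}).Adj f f' := by
    rw [h.adj_iff hn h']
    have h1 := h.1.2
    have h2 := h'.1.2
    omega
  exact hF hf hf' hadj.ne hadj

theorem isIndepSet_of_hasRel (hn : 5 ≤ n) {S : ℕ → ℕ → ℕ → Prop} (hS : IndepRel S)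
    {F : Set (GammaVertex n {1, n - 2})} (hF : HasRel S F) :
    (Gamma n {1, n - 2}).IsIndepSet F := by
  intro f hf f' hf' hne hadj
  obtain ⟨x, y, z, h⟩ := exists_isCoord hn f
  obtain ⟨x', y', z', h'⟩ := exists_isCoord hn f'
  rw [h.adj_iff hn h'] at hadj
  have h1 := (hF f x y z h).1 hf
  have h2 := (hF f' x' y' z' h').1 hf'
  obtain ⟨rfl | rfl, rfl | rfl, h5, h6⟩ := hadj
  · exact h6.2 (hS.unique h1 h2)
  · exact h5.2 (hS.unique (hS.symm h1) h2)
  · exact h6.1 (hS.unique h1 (hS.symm h2))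
  · exact h5.1 (hS.unique (hS.symm h1) (hS.symm h2))

theorem count_eq_two_mul_ncard (hn : 5 ≤ n) {S : ℕ → ℕ → ℕ → Prop} (hS : IndepRel S)
    {F : Set (GammaVertex n {1, n - 2})} (hF : HasRel S F) :
    IndepRel.count S (range n) = 2 * F.ncard := by
  have h1 : IndepRel.count S (range n)
      = #{p ∈ range n ×ˢ range n ×ˢ range n | S p.1 p.2.1 p.2.2} := by
    rw [card_filter, sum_product]
    refine sum_congr rfl fun x hx => ?_
    rw [sum_product, IndepRel.outCount]
  have hfin : F.Finite := Set.toFinite F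
  rw [h1, Set.ncard_eq_toFinset_card F hfin, mul_comm]
  rw [← mul_one (card _)]
  refine card_mul_eq_card_mul (fun p f => IsCoord f p.1 p.2.1 p.2.2) ?_ ?_
  · rintro ⟨x, y, z⟩ hp
    simp only [mem_filter, mem_product, mem_range] at hp
    obtain ⟨f, hf⟩ := exists_isCoord_of_distinct hn (x := x) (y := y) (z := z)
      ⟨hp.1, hS.ne_left hp.2, hS.ne_right hp.2, hS.ne hp.2⟩
    refine card_eq_one.2 ⟨f, ?_⟩
    ext f'
    rw [mem_bipartiteAbove, Set.Finite.mem_toFinset, mem_singleton]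
    constructor
    · exact fun h => h.2.unique hf
    · rintro rfl
      exact ⟨(hF _ _ _ _ hf).2 hp.2, hf⟩
  · intro f hf
    rw [Set.Finite.mem_toFinset] at hf
    obtain ⟨x, y, z, h⟩ := exists_isCoord hn f
    have hSf := (hF _ _ _ _ h).1 hf
    refine card_eq_two.2 ⟨(x, y, z), (x, z, y), ?_, ?_⟩
    · intro he
      simp only [Prod.mk.injEq] at he
      exact h.1.2.2.2 he.2.1
    · ext ⟨x', y', z'⟩
      simp only [mem_bipartiteBelow, h.coord_iff hn, mem_insert, mem_singleton, Prod.mk.injEq,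
        mem_filter, mem_product, mem_range]
      constructor
      · rintro ⟨-, h1, h2⟩
        tauto
      · have := h.1.1
        rintro (⟨rfl, rfl, rfl⟩ | ⟨rfl, rfl, rfl⟩)
        · tauto
        · exact ⟨⟨by tauto, hS.symm hSf⟩, by tauto⟩

/-- Adjacency depends only on equalities between labels, so any permutation of the labels preserves
it. -/
theorem exists_iso (hn : 5 ≤ n) {g : ℕ → ℕ} (hg : Set.BijOn g (range n) (range n)) :
    ∃ φ : Gamma n {1, n - 2} ≃g Gamma n {1, n - 2}, ∀ f x y z, IsCoord f x y z →
      IsCoord (φ f) (g x) (g y) (g z) := by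
  have hlt : ∀ x < n, g x < n := fun x hx => by
    simpa using hg.mapsTo (show x ∈ (range n : Set ℕ) by simpa using hx)
  have hinj : ∀ x < n, ∀ y < n, (g x = g y ↔ x = y) := fun x hx y hy =>
    ⟨fun e => hg.injOn (by simpa using hx) (by simpa using hy) e, fun e => e ▸ rfl⟩
  have hex : ∀ f : GammaVertex n {1, n - 2}, ∃ f' : GammaVertex n {1, n - 2},
      ∀ x y z, IsCoord f x y z → IsCoord f' (g x) (g y) (g z) := by
    intro f
    obtain ⟨x, y, z, h⟩ := exists_isCoord hn f
    obtain ⟨⟨hx, hy, hz⟩, h1, h2, h3⟩ := h.1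
    obtain ⟨f', hf'⟩ := exists_isCoord_of_distinct hn (x := g x) (y := g y) (z := g z)
      ⟨⟨hlt x hx, hlt y hy, hlt z hz⟩, by rwa [Ne, hinj x hx y hy], by rwa [Ne, hinj x hx z hz],
        by rwa [Ne, hinj y hy z hz]⟩
    refine ⟨f', fun x' y' z' h' => ?_⟩
    obtain ⟨rfl, ⟨rfl, rfl⟩ | ⟨rfl, rfl⟩⟩ := (h.coord_iff hn).1 h'
    · exact hf'
    · exact hf'.symm
  choose φ hφ using hex
  have hbij : Function.Bijective φ := by
    rw [← Finite.injective_iff_bijective]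
    intro f f' he
    obtain ⟨x, y, z, h⟩ := exists_isCoord hn f
    obtain ⟨x', y', z', h'⟩ := exists_isCoord hn f'
    have h1 := hφ f x y z h
    have h2 := hφ f' x' y' z' h'
    rw [← he, h1.coord_iff hn] at h2
    obtain ⟨⟨hx, hy, hz⟩, -⟩ := h.1
    obtain ⟨⟨hx', hy', hz'⟩, -⟩ := h'.1
    rw [hinj x' hx' x hx, hinj y' hy' y hy, hinj z' hz' z hz, hinj y' hy' z hz, hinj z' hz' y hy]
      at h2
    exact ((h.coord_iff hn).2 h2).unique h'
  refine ⟨⟨Equiv.ofBijective φ hbij, ?_⟩, hφ⟩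
  intro f f'
  obtain ⟨x, y, z, h⟩ := exists_isCoord hn f
  obtain ⟨x', y', z', h'⟩ := exists_isCoord hn f'
  rw [Equiv.ofBijective_apply, Equiv.ofBijective_apply, (hφ f x y z h).adj_iff hn (hφ _ _ _ _ h'),
    h.adj_iff hn h']
  obtain ⟨⟨hx, hy, hz⟩, -⟩ := h.1
  obtain ⟨⟨hx', hy', hz'⟩, -⟩ := h'.1
  simp only [Ne, hinj x hx y' hy', hinj x hx z' hz', hinj x' hx' y hy, hinj x' hx' z hz,
    hinj y hy y' hy', hinj y hy z' hz', hinj z hz y' hy', hinj z hz z' hz']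

theorem equivalent_of_isModel (hn : 5 ≤ n) {S : ℕ → ℕ → ℕ → Prop}
    {F F' : Set (GammaVertex n {1, n - 2})} (hF' : HasRel S F')
    (hm : IndepRel.IsModel S (coordRel F) (range n)) :
    EquivalentUnderAut (Gamma n {1, n - 2}) F F' := by
  obtain ⟨g, hg, hR⟩ := hm
  rw [card_range] at hg hR
  obtain ⟨φ, hφ⟩ := exists_iso hn hg
  refine ⟨φ.symm, ?_⟩
  ext f
  obtain ⟨x, y, z, h⟩ := exists_isCoord hn f
  obtain ⟨⟨hx, hy, hz⟩, -⟩ := h.1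
  have h1 := hasRel_coordRel F _ _ _ _ (hφ f x y z h)
  rw [hF' f x y z h, ← hR x hx y hy z hz, ← h1]
  constructor
  · rintro ⟨f', hf', rfl⟩
    rwa [RelIso.apply_symm_apply]
  · exact fun hf => ⟨φ f, hf, RelIso.symm_apply_apply φ f⟩

/-! ### Sizes of the three families and the independence number -/

theorem indepRel_chainRel {k : ℕ} {C : ℕ → ℕ → Prop} (hC : ∀ y z, C y z → C z y)
    (hu : ∀ x y z w, x < k → y < k → z < k → w < k → x ≠ y → x ≠ z → x ≠ w → y ≠ z → y ≠ w →
      C y z → C x w → z = w) : IndepRel (IndepRel.chainRel k C) := by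
  refine ⟨?_, fun h => h.1.1, fun h => h.1.2.2, ?_⟩
  · rintro x y z ⟨⟨h1, h2, h3⟩, h⟩
    refine ⟨⟨h2, h1, h3.symm⟩, h.imp (fun h => ⟨h.1, h.2.2, h.2.1⟩)
      fun h => ⟨h.1, h.2.2.1, h.2.1, hC _ _ h.2.2.2⟩⟩
  · rintro x y z w ⟨⟨h1, h2, h3⟩, h⟩ ⟨⟨h1', h2', h3'⟩, h'⟩
    rcases h with h | ⟨a1, a2, a3, a4⟩
    · rcases h' with h' | ⟨b1, b2, b3, b4⟩ <;> omega
    · rcases h' with h' | ⟨b1, b2, b3, b4⟩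
      · omega
      · exact hu x y z w a1 a2 a3 b3 h1 h2 h3' h3 h2' a4 b4

theorem indepRel_triangleRel : IndepRel IndepRel.triangleRel :=
  indepRel_chainRel (fun _ _ _ => trivial) fun x y z w => by omega

theorem indepRel_apexRel (k : ℕ) : IndepRel (IndepRel.apexRel k) :=
  indepRel_chainRel (fun _ _ h => h.symm) fun x y z w => by omega

/-- A new top label `m ≥ k` is pointed in all its triples, adding `m(m-1)` ordered pairs. -/
theorem count_chainRel {k : ℕ} {C : ℕ → ℕ → Prop} (h : IndepRel (IndepRel.chainRel k C))
    (hc : IndepRel.count (IndepRel.chainRel k C) (range k) = 2 * (k.choose 3 + 2)) {m : ℕ}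
    (hm : k ≤ m) : IndepRel.count (IndepRel.chainRel k C) (range m) = 2 * (m.choose 3 + 2) := by
  induction m, hm using Nat.le_induction with
  | base => exact hc
  | succ m hm ih =>
    have hin : IndepRel.inCount (IndepRel.chainRel k C) (range m) m = 0 :=
      sum_eq_zero fun x hx => sum_eq_zero fun z hz => if_neg fun hR => by
        have hx := mem_range.1 hx
        rcases hR.2 with hR | hR <;> omega
    have hout : IndepRel.outCount (IndepRel.chainRel k C) (range m) m = m * (m - 1) := by
      rw [IndepRel.outCount_eq_card, Nat.mul_sub_one]
      conv_rhs => rw [← card_range m, ← offDiag_card]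
      congr 1
      ext ⟨y, z⟩
      simp only [mem_filter, mem_product, mem_range, mem_offDiag]
      constructor
      · exact fun hR => ⟨hR.1.1, hR.1.2, hR.2.1.2.2⟩
      · exact fun hR => ⟨⟨hR.1, hR.2.1⟩, ⟨by omega, by omega, hR.2.2⟩, Or.inl ⟨hm, hR.1, hR.2.1⟩⟩
    rw [range_add_one, IndepRel.count_insert h notMem_range_self, ih, hin, hout]
    have := IndepRel.choose_three_succ m
    omega

theorem count_triangleRel (hn : 3 ≤ n) :
    IndepRel.count IndepRel.triangleRel (range n) = 2 * (n.choose 3 + 2) :=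
  count_chainRel indepRel_triangleRel
    (by
      simp only [IndepRel.count, IndepRel.outCount, IndepRel.chainRel, sum_range_succ,
        sum_range_zero]
      simp) hn

theorem count_apexRel_four (hn : 4 ≤ n) :
    IndepRel.count (IndepRel.apexRel 4) (range n) = 2 * (n.choose 3 + 2) :=
  count_chainRel (indepRel_apexRel 4)
    (by simp [IndepRel.count, IndepRel.outCount, IndepRel.chainRel, sum_range_succ, Nat.choose]) hn

theorem count_apexRel_five (hn : 5 ≤ n) :
    IndepRel.count (IndepRel.apexRel 5) (range n) = 2 * (n.choose 3 + 2) :=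
  count_chainRel (indepRel_apexRel 5)
    (by simp [IndepRel.count, IndepRel.outCount, IndepRel.chainRel, sum_range_succ, Nat.choose]) hn

theorem isExtremal_of_isIndepSet (hn : 5 ≤ n) {F : Set (GammaVertex n {1, n - 2})}
    (hF : (Gamma n {1, n - 2}).IsIndepSet F) (hc : n.choose 3 + 2 ≤ F.ncard) :
    F.ncard = n.choose 3 + 2 ∧ IndepRel.IsExtremal (coordRel F) (range n) := by
  have h := indepRel_coordRel hn hF
  have hcount := count_eq_two_mul_ncard hn h (hasRel_coordRel F)
  obtain ⟨h1, h2⟩ := IndepRel.extremalBound (by omega) (coordRel F) (range n) h (card_range n)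
    (by omega)
  exact ⟨by omega, h2⟩

theorem indepNum_eq (hn : 5 ≤ n) : (Gamma n {1, n - 2}).indepNum = n.choose 3 + 2 := by
  refine IsGreatest.csSup_eq ⟨?_, ?_⟩
  · have hr := hasRel_familyFBar hn
    have h1 := isIndepSet_of_hasRel hn indepRel_triangleRel hr
    have h2 := count_eq_two_mul_ncard hn indepRel_triangleRel hr
    rw [count_triangleRel (by omega)] at h2
    have hfin : (familyFBar (n - 3) n 1 (n - 2)).Finite := Set.toFinite _
    rw [Set.ncard_eq_toFinset_card _ hfin] at h2
    exact ⟨hfin.toFinset, ⟨by rwa [Set.Finite.coe_toFinset], by omega⟩⟩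
  · rintro m ⟨s, hs, rfl⟩
    by_contra hlt
    have h1 := isExtremal_of_isIndepSet hn hs (by rw [Set.ncard_coe_finset]; omega)
    rw [Set.ncard_coe_finset] at h1
    omega

end FlagGraph

/-! ### An automorphism invariant separating the families -/

namespace FlagGraph

open Finset

section Invariant

variable {V : Type*} (G : SimpleGraph V) (F : Set V)

/-- The vertex `v` is not in `F` and has exactly two neighbours in `F`. -/
def IsTwo (v : V) : Prop :=
  v ∉ F ∧ ∃ a ∈ F, ∃ b ∈ F, a ≠ b ∧ G.Adj v a ∧ G.Adj v b ∧ ∀ c ∈ F, G.Adj v c → c = a ∨ c = b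

/-- Some vertex with exactly two neighbours in `F` has no neighbour of this kind. -/
def HasIsolatedTwo : Prop := ∃ v, IsTwo G F v ∧ ∀ w, G.Adj v w → ¬ IsTwo G F w

/-- Some vertex with exactly two neighbours in `F` has exactly one neighbour of this kind. -/
def HasPendantTwo : Prop :=
  ∃ v, IsTwo G F v ∧ ∃ w, G.Adj v w ∧ IsTwo G F w ∧ ∀ w', G.Adj v w' → IsTwo G F w' → w' = w

variable {G F}

theorem IsTwo.map (φ : G ≃g G) {v : V} (h : IsTwo G F v) : IsTwo G (φ '' F) (φ v) := by
  obtain ⟨h1, a, ha, b, hb, hab, hva, hvb, h2⟩ := h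
  refine ⟨?_, φ a, ⟨a, ha, rfl⟩, φ b, ⟨b, hb, rfl⟩, φ.injective.ne hab, φ.map_adj_iff.2 hva,
    φ.map_adj_iff.2 hvb, ?_⟩
  · rintro ⟨u, hu, he⟩
    exact h1 (φ.injective he ▸ hu)
  · rintro _ ⟨c, hc, rfl⟩ hadj
    exact (h2 c hc (φ.map_adj_iff.1 hadj)).imp (congrArg φ) (congrArg φ)

theorem isTwo_map_iff (φ : G ≃g G) {v : V} : IsTwo G (φ '' F) (φ v) ↔ IsTwo G F v := by
  refine ⟨fun h => ?_, IsTwo.map φ⟩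
  have := h.map φ.symm
  rwa [RelIso.symm_apply_apply, ← Set.image_comp, Set.image_congr (g := id), Set.image_id] at this
  exact fun x _ => φ.symm_apply_apply x

theorem HasIsolatedTwo.of_equivalent {F' : Set V} (h : EquivalentUnderAut G F F')
    (hF : HasIsolatedTwo G F) : HasIsolatedTwo G F' := by
  obtain ⟨φ, rfl⟩ := h
  obtain ⟨v, hv, hw⟩ := hF
  refine ⟨φ v, hv.map φ, fun w hadj hw' => ?_⟩
  obtain ⟨w, rfl⟩ := φ.surjective w
  exact hw w (φ.map_adj_iff.1 hadj) ((isTwo_map_iff φ).1 hw')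

theorem HasPendantTwo.of_equivalent {F' : Set V} (h : EquivalentUnderAut G F F')
    (hF : HasPendantTwo G F) : HasPendantTwo G F' := by
  obtain ⟨φ, rfl⟩ := h
  obtain ⟨v, hv, w, hvw, hw, hu⟩ := hF
  refine ⟨φ v, hv.map φ, φ w, φ.map_adj_iff.2 hvw, hw.map φ, fun w' hadj hw' => ?_⟩
  obtain ⟨w', rfl⟩ := φ.surjective w'
  rw [hu w' (φ.map_adj_iff.1 hadj) ((isTwo_map_iff φ).1 hw')]

theorem EquivalentUnderAut.symm {F' : Set V} (h : EquivalentUnderAut G F F') :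
    EquivalentUnderAut G F' F := by
  obtain ⟨φ, rfl⟩ := h
  refine ⟨φ.symm, ?_⟩
  rw [← Set.image_comp, Set.image_congr (g := id), Set.image_id]
  exact fun x _ => φ.symm_apply_apply x

end Invariant

variable {n x y z : ℕ} {f f' : GammaVertex n {1, n - 2}} {S : ℕ → ℕ → ℕ → Prop}
  {F : Set (GammaVertex n {1, n - 2})}

/-- The vertex with coordinates `p, x, w` is a neighbour of the vertex with coordinates
`x, y, z`. -/
def NbrRel (n x y z p w : ℕ) : Prop := (p = y ∨ p = z) ∧ w < n ∧ w ≠ x ∧ w ≠ y ∧ w ≠ z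

/-- The relation `IsTwo` in coordinates. -/
def TwoRel (S : ℕ → ℕ → ℕ → Prop) (n x y z : ℕ) : Prop :=
  ¬ S x y z ∧ ∃ p w p' w', (NbrRel n x y z p w ∧ S p x w) ∧ (NbrRel n x y z p' w' ∧ S p' x w') ∧
    (p ≠ p' ∨ w ≠ w') ∧ ∀ q v, NbrRel n x y z q v → S q x v → (q = p ∧ v = w) ∨ (q = p' ∧ v = w')

theorem exists_of_nbrRel (hn : 5 ≤ n) (h : IsCoord f x y z) {p w : ℕ} (hp : NbrRel n x y z p w) :
    ∃ f', IsCoord f' p x w ∧ (Gamma n {1, n - 2}).Adj f f' := by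
  have hd := h.1
  simp only [Distinct, NbrRel] at hd hp
  obtain ⟨f', hf'⟩ := exists_isCoord_of_distinct hn (x := p) (y := x) (z := w)
    ⟨by omega, by omega, by omega, by omega⟩
  refine ⟨f', hf', (h.adj_iff hn hf').2 (by omega)⟩

theorem exists_nbrRel_of_adj (hn : 5 ≤ n) (h : IsCoord f x y z)
    (hadj : (Gamma n {1, n - 2}).Adj f f') : ∃ p w, NbrRel n x y z p w ∧ IsCoord f' p x w := by
  obtain ⟨x', y', z', h'⟩ := exists_isCoord hn f'
  have hd := h.1
  have hd' := h'.1
  rw [h.adj_iff hn h'] at hadj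
  simp only [Distinct] at hd hd'
  rcases hadj.1 with rfl | rfl
  · exact ⟨x', z', ⟨by omega, by omega, by omega, by omega, by omega⟩, h'⟩
  · exact ⟨x', y', ⟨by omega, by omega, by omega, by omega, by omega⟩, h'.symm⟩

theorem isTwo_iff (hn : 5 ≤ n) (hF : HasRel S F) (h : IsCoord f x y z) :
    IsTwo (Gamma n {1, n - 2}) F f ↔ TwoRel S n x y z := by
  have hco : ∀ {g : GammaVertex n {1, n - 2}} {p w q v : ℕ}, IsCoord g p x w → IsCoord g q x v →
      q = p ∧ v = w := by
    intro g p w q v hg hg'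
    have := (hg.coord_iff hn).1 hg'
    have := hg.1.2
    omega
  constructor
  · rintro ⟨h1, a, ha, b, hb, hab, hfa, hfb, h2⟩
    obtain ⟨p, w, hp, hac⟩ := exists_nbrRel_of_adj hn h hfa
    obtain ⟨p', w', hp', hbc⟩ := exists_nbrRel_of_adj hn h hfb
    refine ⟨fun hS => h1 ((hF _ _ _ _ h).2 hS), p, w, p', w', ⟨hp, (hF _ _ _ _ hac).1 ha⟩,
      ⟨hp', (hF _ _ _ _ hbc).1 hb⟩, ?_, fun q v hq hS => ?_⟩
    · by_contra! hc
      obtain ⟨rfl, rfl⟩ := hc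
      exact hab (hac.unique hbc)
    · obtain ⟨c, hc, hadj⟩ := exists_of_nbrRel hn h hq
      rcases h2 c ((hF _ _ _ _ hc).2 hS) hadj with rfl | rfl
      · exact Or.inl (hco hac hc)
      · exact Or.inr (hco hbc hc)
  · rintro ⟨h1, p, w, p', w', ⟨hp, hS⟩, ⟨hp', hS'⟩, hne, h2⟩
    obtain ⟨a, ha, hfa⟩ := exists_of_nbrRel hn h hp
    obtain ⟨b, hb, hfb⟩ := exists_of_nbrRel hn h hp'
    refine ⟨fun hf => h1 ((hF _ _ _ _ h).1 hf), a, (hF _ _ _ _ ha).2 hS, b, (hF _ _ _ _ hb).2 hS',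
      ?_, hfa, hfb, fun c hc hadj => ?_⟩
    · rintro rfl
      have := hco ha hb
      omega
    · obtain ⟨q, v, hq, hcc⟩ := exists_nbrRel_of_adj hn h hadj
      rcases h2 q v hq ((hF _ _ _ _ hcc).1 hc) with ⟨rfl, rfl⟩ | ⟨rfl, rfl⟩
      · exact Or.inl (hcc.unique ha)
      · exact Or.inr (hcc.unique hb)

theorem not_twoRel {p w p' w' p'' w'' : ℕ} (h1 : NbrRel n x y z p w) (hS1 : S p x w)
    (h2 : NbrRel n x y z p' w') (hS2 : S p' x w') (h3 : NbrRel n x y z p'' w'') (hS3 : S p'' x w'')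
    (h12 : p ≠ p' ∨ w ≠ w') (h13 : p ≠ p'' ∨ w ≠ w'') (h23 : p' ≠ p'' ∨ w' ≠ w'') :
    ¬ TwoRel S n x y z := by
  rintro ⟨-, q, v, q', v', -, -, -, hu⟩
  have e1 := hu _ _ h1 hS1
  have e2 := hu _ _ h2 hS2
  have e3 := hu _ _ h3 hS3
  omega

theorem TwoRel.symm (hS : IndepRel S) (h : TwoRel S n x y z) : TwoRel S n x z y := by
  obtain ⟨h1, p, w, p', w', h2, h3, h4, h5⟩ := h
  have hN : ∀ p w, NbrRel n x z y p w ↔ NbrRel n x y z p w := fun p w => by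
    simp only [NbrRel]
    omega
  exact ⟨fun h => h1 (hS.symm h), p, w, p', w', by rwa [hN], by rwa [hN], h4,
    fun q v hq => h5 q v ((hN q v).1 hq)⟩

theorem exists_three_lt_five (x z : ℕ) : ∃ a b c : ℕ, (a < 5 ∧ b < 5 ∧ c < 5) ∧
    (a ≠ x ∧ b ≠ x ∧ c ≠ x) ∧ (a ≠ z ∧ b ≠ z ∧ c ≠ z) ∧ a ≠ b ∧ a ≠ c ∧ b ≠ c := by
  have h : 2 < #(range 5 \ {x, z}) := by
    have h1 := le_card_sdiff {x, z} (range 5)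
    have h2 : #({x, z} : Finset ℕ) ≤ 2 := card_le_two
    rw [card_range] at h1
    omega
  obtain ⟨a, ha, b, hb, c, hc, hne⟩ := two_lt_card.1 h
  simp only [mem_sdiff, mem_range, mem_insert, mem_singleton] at ha hb hc
  exact ⟨a, b, c, by omega, by omega, by omega, hne⟩

/-- The triples `(y, {x, w})` with `w < 5` and `w ≠ x, z` are at least three neighbours in the
family. -/
theorem not_twoRel_of_max {k : ℕ} {C : ℕ → ℕ → Prop} (hk : k ≤ 5) (hd : Distinct n x y z)
    (hy : 5 ≤ y) (hx : x < y) : ¬ TwoRel (IndepRel.chainRel k C) n x y z := by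
  obtain ⟨a, b, c, h1, h2, h3, h4⟩ := exists_three_lt_five x z
  simp only [Distinct] at hd
  have key : ∀ w, w < 5 → w ≠ x → w ≠ z → NbrRel n x y z y w ∧ IndepRel.chainRel k C y x w :=
    fun w e1 e2 e3 => ⟨by simp [NbrRel]; omega, by omega, Or.inl (by omega)⟩
  have ka := key a h1.1 h2.1 h3.1
  have kb := key b h1.2.1 h2.2.1 h3.2.1
  have kc := key c h1.2.2 h2.2.2 h3.2.2
  exact not_twoRel ka.1 ka.2 kb.1 kb.2 kc.1 kc.2 (Or.inr h4.1) (Or.inr h4.2.1) (Or.inr h4.2.2)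

theorem TwoRel.lt_five {k : ℕ} {C : ℕ → ℕ → Prop} (hk : k ≤ 5) (hd : Distinct n x y z)
    (hS : IndepRel (IndepRel.chainRel k C)) (h : TwoRel (IndepRel.chainRel k C) n x y z) :
    x < 5 ∧ y < 5 ∧ z < 5 := by
  have hd' : Distinct n x z y := by
    simp only [Distinct] at *
    omega
  have h1 := fun h1 h2 => not_twoRel_of_max hk hd h1 h2 h
  have h2 := fun h1 h2 => not_twoRel_of_max hk hd' h1 h2 (h.symm hS)
  by_contra hc
  simp only [Distinct] at hd
  refine h.1 ⟨by omega, Or.inl ?_⟩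
  by_cases hxy : x < y
  · have : ¬ 5 ≤ y := fun h => h1 h hxy
    by_cases hxz : x < z
    · have : ¬ 5 ≤ z := fun h => h2 h hxz
      omega
    · omega
  · by_cases hxz : x < z
    · have : ¬ 5 ≤ z := fun h => h2 h hxz
      omega
    · omega

/-- For distinct labels in `{1, …, 4}` the two neighbours in the family are `(y, {x, 0})` and `(z,
{x, 0})`. -/
theorem twoRel_apexRel_five_iff (hn : 5 ≤ n) (hd : Distinct n x y z) :
    TwoRel (IndepRel.apexRel 5) n x y z ↔
      (1 ≤ x ∧ x < 5) ∧ (1 ≤ y ∧ y < 5) ∧ (1 ≤ z ∧ z < 5) := by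
  constructor
  · intro h
    have h5 := TwoRel.lt_five le_rfl hd (indepRel_apexRel 5) h
    simp only [Distinct] at hd
    have h1 := h.1
    simp only [IndepRel.apexRel, IndepRel.chainRel] at h1
    have hyz : 1 ≤ y ∧ 1 ≤ z := by omega
    rcases Nat.eq_zero_or_pos x with rfl | hx
    · exfalso
      obtain ⟨a, b, c, e1, e2, e3, e4⟩ := exists_three_lt_five y z
      obtain ⟨v, w, hv, hw, hvw⟩ : ∃ v w : ℕ, (v < 5 ∧ v ≠ 0 ∧ v ≠ y ∧ v ≠ z) ∧
          (w < 5 ∧ w ≠ 0 ∧ w ≠ y ∧ w ≠ z) ∧ v ≠ w := by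
        by_cases a = 0
        · exact ⟨b, c, by omega, by omega, by omega⟩
        · by_cases b = 0
          · exact ⟨a, c, by omega, by omega, by omega⟩
          · exact ⟨a, b, by omega, by omega, by omega⟩
      refine not_twoRel (p := y) (w := v) (p' := y) (w' := w) (p'' := z) (w'' := v) ?_ ?_ ?_ ?_ ?_
        ?_ (by omega) (by omega) (by omega) h
      all_goals simp [NbrRel, IndepRel.apexRel, IndepRel.chainRel]; omega
    · omega
  · intro h
    simp only [Distinct] at hd
    refine ⟨?_, y, 0, z, 0, ?_, ?_, by omega, fun q v hN hS => ?_⟩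
    all_goals simp [NbrRel, IndepRel.apexRel, IndepRel.chainRel] at *; omega

/-- For `(x, {3, z})` the two neighbours are `(3, {x, r})` and `(z, {x, r})`, where `{x, z, r} = {0,
1, 2}`. For `(3, {4, z})` they are `(4, {3, r})` and `(4, {3, s})`, where `{r, s, z} = {0, 1, 2}`.
-/
theorem twoRel_triangleRel_iff (hn : 5 ≤ n) (hd : Distinct n x y z) :
    TwoRel IndepRel.triangleRel n x y z ↔ (y = 3 ∧ x < 3 ∧ z < 3) ∨ (z = 3 ∧ x < 3 ∧ y < 3) ∨
      (x = 3 ∧ (y = 4 ∧ z < 3 ∨ z = 4 ∧ y < 3)) := by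
  have h4 : ∀ y z, Distinct n x y z → TwoRel IndepRel.triangleRel n x y z → y = 4 → x < 5 → z < 5 →
      x = 3 := by
    rintro y z hd h rfl hx hz
    simp only [Distinct] at hd
    by_contra hx3
    obtain ⟨r, hr, hrx, hrz⟩ : ∃ r < 3, r ≠ x ∧ r ≠ z := by
      by_cases h0 : x ≠ 0 ∧ z ≠ 0
      · exact ⟨0, by omega, by omega, by omega⟩
      · by_cases h1 : x ≠ 1 ∧ z ≠ 1
        · exact ⟨1, by omega, by omega, by omega⟩
        · exact ⟨2, by omega, by omega, by omega⟩
    by_cases hz3 : z = 3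
    · obtain ⟨s, hs, hsx, hsr⟩ : ∃ s < 3, s ≠ x ∧ s ≠ r := ⟨3 - x - r, by omega, by omega, by omega⟩
      refine not_twoRel (p := 4) (w := r) (p' := 4) (w' := s) (p'' := z) (w'' := r) ?_ ?_ ?_ ?_ ?_
        ?_ (by omega) (by omega) (by omega) h
      all_goals simp [NbrRel, IndepRel.triangleRel, IndepRel.chainRel]; omega
    · refine not_twoRel (p := 4) (w := r) (p' := 4) (w' := 3) (p'' := z) (w'' := r) ?_ ?_ ?_ ?_ ?_
        ?_ (by omega) (by omega) (by omega) h
      all_goals simp [NbrRel, IndepRel.triangleRel, IndepRel.chainRel]; omega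
  constructor
  · intro h
    have h5 := TwoRel.lt_five (by omega) hd indepRel_triangleRel h
    have hd' : Distinct n x z y := by
      simp only [Distinct] at *
      omega
    have e1 := fun e => h4 y z hd h e h5.1 h5.2.2
    have e2 := fun e => h4 z y hd' (h.symm indepRel_triangleRel) e h5.1 h5.2.1
    have h1 := h.1
    simp only [IndepRel.triangleRel, IndepRel.chainRel, and_true] at h1
    simp only [Distinct] at hd
    by_cases hy : y = 4
    · have := e1 hy
      omega
    · by_cases hz : z = 4
      · have := e2 hz
        omega
      · omega
  · have h3 : ∀ y z, Distinct n x y z → (y = 3 ∧ x < 3 ∧ z < 3) ∨ (x = 3 ∧ y = 4 ∧ z < 3) →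
        TwoRel IndepRel.triangleRel n x y z := by
      rintro y z hd (⟨rfl, hx, hz⟩ | ⟨rfl, rfl, hz⟩)
      · simp only [Distinct] at hd
        refine ⟨?_, 3, 3 - x - z, z, 3 - x - z, ?_, ?_, by omega, fun q v hN hS => ?_⟩
        all_goals
          simp [NbrRel, IndepRel.triangleRel, IndepRel.chainRel] at *; omega
      · simp only [Distinct] at hd
        obtain ⟨r, s, hr, hs, hrs, hrz, hsz⟩ : ∃ r s, r < 3 ∧ s < 3 ∧ r ≠ s ∧ r ≠ z ∧ s ≠ z := by
          by_cases h0 : z = 0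
          · exact ⟨1, 2, by omega, by omega, by omega, by omega, by omega⟩
          · exact ⟨0, 3 - z, by omega, by omega, by omega, by omega, by omega⟩
        refine ⟨?_, 4, r, 4, s, ?_, ?_, by omega, fun q v hN hS => ?_⟩
        all_goals
          simp [NbrRel, IndepRel.triangleRel, IndepRel.chainRel] at * <;> omega
    intro h
    have hd' : Distinct n x z y := by
      simp only [Distinct] at *
      omega
    rcases h with h | h | ⟨h, h' | h'⟩
    · exact h3 y z hd (Or.inl h)
    · exact (h3 z y hd' (Or.inl h)).symm indepRel_triangleRel
    · exact h3 y z hd (Or.inr ⟨h, h'⟩)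
    · exact (h3 z y hd' (Or.inr ⟨h, h'⟩)).symm indepRel_triangleRel

theorem exists_two_twos_apexRel_five (hn : 5 ≤ n) (hF : HasRel (IndepRel.apexRel 5) F)
    (h : IsTwo (Gamma n {1, n - 2}) F f) :
    ∃ g g', g ≠ g' ∧ ((Gamma n {1, n - 2}).Adj f g ∧ IsTwo (Gamma n {1, n - 2}) F g) ∧
      (Gamma n {1, n - 2}).Adj f g' ∧ IsTwo (Gamma n {1, n - 2}) F g' := by
  obtain ⟨x, y, z, hf⟩ := exists_isCoord hn f
  rw [isTwo_iff hn hF hf, twoRel_apexRel_five_iff hn hf.1] at h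
  have hd := hf.1
  simp only [Distinct] at hd
  -- As `1 + 2 + 3 + 4 = 10`, this is the remaining label of `{1, …, 4}`.
  have hw : 1 ≤ 10 - x - y - z ∧ 10 - x - y - z < 5 ∧ 10 - x - y - z ≠ x ∧ 10 - x - y - z ≠ y ∧
      10 - x - y - z ≠ z := by omega
  generalize 10 - x - y - z = w at hw
  obtain ⟨g, hg, hfg⟩ := exists_of_nbrRel hn hf (p := y) (w := w) (by simp [NbrRel]; omega)
  obtain ⟨g', hg', hfg'⟩ := exists_of_nbrRel hn hf (p := z) (w := w) (by simp [NbrRel]; omega)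
  refine ⟨g, g', ?_, ⟨hfg, ?_⟩, hfg', ?_⟩
  · rintro rfl
    have := (hg.coord_iff hn).1 hg'
    omega
  · rw [isTwo_iff hn hF hg, twoRel_apexRel_five_iff hn hg.1]
    omega
  · rw [isTwo_iff hn hF hg', twoRel_apexRel_five_iff hn hg'.1]
    omega

theorem not_hasIsolatedTwo_apexRel_five (hn : 5 ≤ n) (hF : HasRel (IndepRel.apexRel 5) F) :
    ¬ HasIsolatedTwo (Gamma n {1, n - 2}) F := by
  rintro ⟨f, hf, h⟩
  obtain ⟨g, -, -, hg, -⟩ := exists_two_twos_apexRel_five hn hF hf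
  exact h g hg.1 hg.2

theorem not_hasPendantTwo_apexRel_five (hn : 5 ≤ n) (hF : HasRel (IndepRel.apexRel 5) F) :
    ¬ HasPendantTwo (Gamma n {1, n - 2}) F := by
  rintro ⟨f, hf, w, -, -, h⟩
  obtain ⟨g, g', hne, hg, hg'⟩ := exists_two_twos_apexRel_five hn hF hf
  exact hne ((h g hg.1 hg.2).trans (h g' hg'.1 hg'.2).symm)

theorem not_hasIsolatedTwo_triangleRel (hn : 5 ≤ n) (hF : HasRel IndepRel.triangleRel F) :
    ¬ HasIsolatedTwo (Gamma n {1, n - 2}) F := by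
  rintro ⟨f, hf, h⟩
  obtain ⟨x, y, z, hc⟩ := exists_isCoord hn f
  rw [isTwo_iff hn hF hc, twoRel_triangleRel_iff hn hc.1] at hf
  have hd := hc.1
  simp only [Distinct] at hd
  have key : ∀ p w, NbrRel n x y z p w → (x = 3 ∧ p < 3 ∧ w < 3) ∨ (w = 3 ∧ p < 3 ∧ x < 3) ∨
      (p = 3 ∧ (x = 4 ∧ w < 3 ∨ w = 4 ∧ x < 3)) → False := by
    intro p w hN hw
    obtain ⟨g, hg, hfg⟩ := exists_of_nbrRel hn hc hN
    refine h g hfg ?_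
    rwa [isTwo_iff hn hF hg, twoRel_triangleRel_iff hn hg.1]
  rcases hf with hf | hf | ⟨hx, hf⟩
  · exact key 3 4 (by simp [NbrRel]; omega) (by omega)
  · exact key 3 4 (by simp [NbrRel]; omega) (by omega)
  · obtain ⟨q, hq, hq'⟩ : ∃ q < 3, q = y ∨ q = z := by
      rcases hf with hf | hf
      · exact ⟨z, hf.2, Or.inr rfl⟩
      · exact ⟨y, hf.2, Or.inl rfl⟩
    by_cases hq0 : q = 0
    · exact key q 1 (by simp [NbrRel]; omega) (by omega)
    · exact key q 0 (by simp [NbrRel]; omega) (by omega)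

/-- The vertex `(0, {3, 1})` has `(3, {0, 4})` as its only neighbour of the same kind. -/
theorem hasPendantTwo_triangleRel (hn : 5 ≤ n) (hF : HasRel IndepRel.triangleRel F) :
    HasPendantTwo (Gamma n {1, n - 2}) F := by
  obtain ⟨f, hf⟩ := exists_isCoord_of_distinct hn (x := 0) (y := 3) (z := 1)
    ⟨by omega, by omega, by omega, by omega⟩
  obtain ⟨g, hg, hfg⟩ := exists_of_nbrRel hn hf (p := 3) (w := 4) (by simp [NbrRel]; omega)
  refine ⟨f, ?_, g, hfg, ?_, fun g' hfg' hg' => ?_⟩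
  · rw [isTwo_iff hn hF hf, twoRel_triangleRel_iff hn hf.1]
    omega
  · rw [isTwo_iff hn hF hg, twoRel_triangleRel_iff hn hg.1]
    omega
  · obtain ⟨p, w, hN, hpw⟩ := exists_nbrRel_of_adj hn hf hfg'
    rw [isTwo_iff hn hF hpw, twoRel_triangleRel_iff hn hpw.1] at hg'
    simp only [NbrRel] at hN
    obtain ⟨rfl, rfl⟩ : p = 3 ∧ w = 4 := by omega
    exact hpw.unique hg

/-- The isolated vertex is `(1, {2, 3})`. A neighbour `(p, {1, w})` outside the family has `w ≥ 4`,
and then too many neighbours inside it. -/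
theorem hasIsolatedTwo_apexRel_four (hn : 5 ≤ n) (hF : HasRel (IndepRel.apexRel 4) F) :
    HasIsolatedTwo (Gamma n {1, n - 2}) F := by
  obtain ⟨f, hf⟩ := exists_isCoord_of_distinct hn (x := 1) (y := 2) (z := 3)
    ⟨by omega, by omega, by omega, by omega⟩
  refine ⟨f, ?_, fun g hfg hg => ?_⟩
  · rw [isTwo_iff hn hF hf]
    refine ⟨?_, 2, 0, 3, 0, ?_, ?_, by omega, fun q v hN hS => ?_⟩
    all_goals simp [NbrRel, IndepRel.apexRel, IndepRel.chainRel] at * <;> omega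
  · obtain ⟨p, w, hN, hpw⟩ := exists_nbrRel_of_adj hn hf hfg
    rw [isTwo_iff hn hF hpw] at hg
    have h1 := hg.1
    simp only [NbrRel, IndepRel.apexRel, IndepRel.chainRel] at h1 hN
    -- Here `5 - p` is the other element of `{2, 3}`.
    refine not_twoRel (p := w) (w := 0) (p' := w) (w' := 5 - p) (p'' := 1) (w'' := 0) ?_ ?_ ?_ ?_ ?_
      ?_ (by omega) (by omega) (by omega) hg
    all_goals simp [NbrRel, IndepRel.apexRel, IndepRel.chainRel]; omega

end FlagGraph

/-! ### The main theorem -/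

open FlagGraph in
theorem mainTheorem3 (n : ℕ) (hn : 5 ≤ n) :
    -- the independence number
    (Gamma n {1, n - 2}).indepNum = n.choose 3 + 2 ∧
    -- the three families are independent sets of this cardinality
    ((Gamma n {1, n - 2}).IsIndepSet (familyF (n - 5) n 1 (n - 2)) ∧
      (familyF (n - 5) n 1 (n - 2)).ncard = n.choose 3 + 2) ∧
    ((Gamma n {1, n - 2}).IsIndepSet (familyF (n - 4) n 1 (n - 2)) ∧
      (familyF (n - 4) n 1 (n - 2)).ncard = n.choose 3 + 2) ∧
    ((Gamma n {1, n - 2}).IsIndepSet (familyFBar (n - 3) n 1 (n - 2)) ∧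
      (familyFBar (n - 3) n 1 (n - 2)).ncard = n.choose 3 + 2) ∧
    -- they are pairwise non-equivalent
    ¬ EquivalentUnderAut (Gamma n {1, n - 2})
        (familyF (n - 5) n 1 (n - 2)) (familyF (n - 4) n 1 (n - 2)) ∧
    ¬ EquivalentUnderAut (Gamma n {1, n - 2})
        (familyF (n - 5) n 1 (n - 2)) (familyFBar (n - 3) n 1 (n - 2)) ∧
    ¬ EquivalentUnderAut (Gamma n {1, n - 2})
        (familyF (n - 4) n 1 (n - 2)) (familyFBar (n - 3) n 1 (n - 2)) ∧
    -- every independent set of this cardinality is equivalent to one of them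
    ∀ F : Finset (GammaVertex n {1, n - 2}),
      (Gamma n {1, n - 2}).IsNIndepSet (n.choose 3 + 2) F →
        EquivalentUnderAut (Gamma n {1, n - 2}) F (familyF (n - 5) n 1 (n - 2)) ∨
        EquivalentUnderAut (Gamma n {1, n - 2}) F (familyF (n - 4) n 1 (n - 2)) ∨
        EquivalentUnderAut (Gamma n {1, n - 2}) F (familyFBar (n - 3) n 1 (n - 2)) := by
  have r5 := hasRel_familyF_apex hn hn
  have r4 := hasRel_familyF_apex (k := 4) hn (by omega)
  have rb := hasRel_familyFBar hn
  have i5 := indepRel_apexRel 5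
  have i4 := indepRel_apexRel 4
  have ib := indepRel_triangleRel
  have c5 := count_eq_two_mul_ncard hn i5 r5
  have c4 := count_eq_two_mul_ncard hn i4 r4
  have cb := count_eq_two_mul_ncard hn ib rb
  rw [count_apexRel_five hn] at c5
  rw [count_apexRel_four (by omega)] at c4
  rw [count_triangleRel (by omega)] at cb
  refine ⟨indepNum_eq hn, ⟨isIndepSet_of_hasRel hn i5 r5, by omega⟩,
    ⟨isIndepSet_of_hasRel hn i4 r4, by omega⟩, ⟨isIndepSet_of_hasRel hn ib rb, by omega⟩,
    fun h => ?_, fun h => ?_, fun h => ?_, fun F hF => ?_⟩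
  -- Only the family with core on 4 labels has an isolated vertex of the invariant graph. Between
  -- the other two, only the triangle core gives a pendant vertex.
  · exact not_hasIsolatedTwo_apexRel_five hn r5
      ((hasIsolatedTwo_apexRel_four hn r4).of_equivalent (EquivalentUnderAut.symm h))
  · exact not_hasPendantTwo_apexRel_five hn r5
      ((hasPendantTwo_triangleRel hn rb).of_equivalent (EquivalentUnderAut.symm h))
  · exact not_hasIsolatedTwo_triangleRel hn rb
      ((hasIsolatedTwo_apexRel_four hn r4).of_equivalent h)
  · obtain ⟨-, hm⟩ := isExtremal_of_isIndepSet hn hF.isIndepSet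
      (by rw [Set.ncard_coe_finset, hF.card_eq])
    rcases hm with hm | ⟨-, hm⟩ | ⟨-, hm⟩
    · exact Or.inr (Or.inr (equivalent_of_isModel hn rb hm))
    · exact Or.inr (Or.inl (equivalent_of_isModel hn r4 hm))
    · exact Or.inl (equivalent_of_isModel hn r5 hm)
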